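/- Let $n\in\mathbb N$. For $f$ on $\mathbb R^n$ put $\mathcal V(f)=\int_{\mathbb R^n}|x|^2|f(x)|^2\,dx\in[0,+\infty]$, and for a bounded operator $M$ on $L^2(\mathbb R^n)$ put $$\mu(M)=\inf_{u\in\mathscr S(\mathbb R^n),\ \|u\|_{L^2(\mathbb R^n)}=1}\sqrt{\mathcal V(Mu)\,\mathcal V(u)} .$$ Let $\hat u(\xi)=\int e^{-2i\pi x\cdot\xi}u(x)\,dx$ and $D=\frac1{2i\pi}\partial$. The metaplectic group $\mathrm{Mp}(n,\mathbb R)$ is the subgroup of the unitary group of $L^2(\mathbb R^n)$ generated by the following operators: $\pm$ the multiplication by $e^{i\pi\langle Ax,x\rangle}$, with $A$ real symmetric; the maps $v\mapsto e^{i\pi m/2}|\det B|^{1/2}v(Bx)$, with $B\in GL(n,\mathbb R)$ and $m\in\mathbb Z/4\mathbb Z$ such that $e^{i\pi m}=\operatorname{sign}(\det B)$; and $\pm$ the Fourier multiplier $e^{i\pi\langle CD,D\rangle}$, with $C$ real symmetric. On $\mathbb R^n\times\mathbb R^n$ let $[(x,\xi),(y,\eta)]=\xi\cdot y-\eta\cdot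 x$ and let $\mathrm{Sp}(2n,\mathbb R)$ be the group of matrices that preserve this form. For $Y=(y,\eta)$ let $L_Y(X)=[Y,X]$, with Weyl quantization $\mathrm{Op}(L_Y)=\eta\cdot x-y\cdot D$. For $M\in\mathrm{Mp}(n,\mathbb R)$, let $\Psi(M)$ be the unique $\chi\in\mathrm{Sp}(2n,\mathbb R)$ such that $M^*\,\mathrm{Op}(L_Y)\,M=\mathrm{Op}(L_{\chi^{-1}Y})$ on $\mathscr S(\mathbb R^n)$ for all $Y\in\mathbb R^{2n}$. Theorem. Let $\mathcal M\in\mathrm{Mp}(n,\mathbb R)$ and let $\Xi=\Psi(\mathcal M)$ be written in four $n\times n$ blocks, $\Xi=\begin{pmatrix}\Xi_{11}&\Xi_{12}\\ \Xi_{21}&\Xi_{22}\end{pmatrix}$. Then $$\mu(\mathcal M)=\frac1{4\pi}\operatorname{trace}\bigl((\Xi_{12}^*\Xi_{12})^{1/2}\bigr)=\frac1{4\pi}\|\Xi_{12}\|_{S^1},$$ where $\|T\|_{S^p}=\bigl(\operatorname{trace}\,(T^*T)^{p/2}\bigr)^{1/p}$ is the Schatten norm of index $p$. (No invertibility of $\Xi_{12}$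 is assumed.) -/

import Mathlib

open MeasureTheory Matrix FourierTransform SchwartzMap LineDeriv
open scoped ENNReal NNReal MatrixOrder

noncomputable section

namespace Metaplectic

/-- Euclidean space `ℝⁿ`. -/
abbrev RSpace (n : ℕ) : Type := EuclideanSpace ℝ (Fin n)

/-- The Hilbert space `L²(ℝⁿ)` of complex-valued functions, for Lebesgue measure. -/
abbrev L2 (n : ℕ) : Type := Lp (α := RSpace n) ℂ 2

/-- The group of unitary operators on `L²(ℝⁿ)`. -/
abbrev UnitaryOp (n : ℕ) : Type := L2 n ≃ₗᵢ[ℂ] L2 n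

/-- The action `x ↦ B x` of a matrix on `ℝⁿ`. -/
def act {n : ℕ} (B : Matrix (Fin n) (Fin n) ℝ) (x : RSpace n) : RSpace n :=
  WithLp.toLp 2 (B *ᵥ x.ofLp)

/-- The quadratic form `⟨A x, x⟩` of a matrix on `ℝⁿ`. -/
def quad {n : ℕ} (A : Matrix (Fin n) (Fin n) ℝ) (x : RSpace n) : ℝ :=
  (A *ᵥ x.ofLp) ⬝ᵥ x.ofLp

/-! ### Weighted compositions `f ↦ φ(x) f(B x)` as unitary operators -/

theorem continuous_act {n : ℕ} (B : Matrix (Fin n) (Fin n) ℝ) : Continuous (act B) := by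
  unfold act
  fun_prop

theorem continuous_quad {n : ℕ} (A : Matrix (Fin n) (Fin n) ℝ) : Continuous (quad A) := by
  unfold quad
  fun_prop

theorem act_act {n : ℕ} (B C : Matrix (Fin n) (Fin n) ℝ) (x : RSpace n) :
    act B (act C x) = act (B * C) x := by
  simp [act]

theorem act_one {n : ℕ} (x : RSpace n) : act (1 : Matrix (Fin n) (Fin n) ℝ) x = x := by
  simp [act]

theorem det_GL_ne_zero {n : ℕ} (B : GL (Fin n) ℝ) :
    (B : Matrix (Fin n) (Fin n) ℝ).det ≠ 0 :=
  ((Matrix.isUnit_iff_isUnit_det _).1 B.isUnit).ne_zero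

theorem map_act_volume {n : ℕ} (B : GL (Fin n) ℝ) :
    (volume : Measure (RSpace n)).map (act B.val) =
      ENNReal.ofReal |(B.val.det)⁻¹| • volume := by
  have hdet : LinearMap.det (Matrix.toLpLin 2 2 B.val) = B.val.det := by
    rw [Matrix.toLpLin_eq_toLin, LinearMap.det_toLin]
  have h := Measure.map_linearMap_addHaar_eq_smul_addHaar (volume : Measure (RSpace n))
    (f := Matrix.toLpLin 2 2 B.val) (by rw [hdet]; exact det_GL_ne_zero B)
  rw [hdet] at h
  exact h

theorem quasiMeasurePreserving_act {n : ℕ} (B : GL (Fin n) ℝ) :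
    Measure.QuasiMeasurePreserving (act B.val) (volume : Measure (RSpace n)) volume :=
  ⟨(continuous_act _).measurable, by
    rw [map_act_volume]; exact Measure.smul_absolutelyContinuous⟩

theorem eLpNorm_weightedComp {n : ℕ} (φ : RSpace n → ℂ) (B : GL (Fin n) ℝ)
    (hB : ∀ x, ‖φ x‖ = √|B.val.det|) (f : RSpace n → ℂ) (hf : AEStronglyMeasurable f volume) :
    eLpNorm (fun x => φ x * f (act B.val x)) 2 volume = eLpNorm f 2 volume := by
  have hd : 0 < |B.val.det| := abs_pos.2 (det_GL_ne_zero B)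
  have h1 : eLpNorm (fun x => φ x * f (act B.val x)) 2 volume
      = eLpNorm ((√|B.val.det|) • fun x => f (act B.val x)) 2 volume := by
    apply eLpNorm_congr_norm_ae
    filter_upwards with x
    simp [hB, abs_of_nonneg (Real.sqrt_nonneg _)]
  have h2 : eLpNorm (fun x => f (act B.val x)) 2 volume
      = ENNReal.ofReal |(B.val.det)⁻¹| ^ (1 / 2 : ℝ) * eLpNorm f 2 volume := by
    have h3 : eLpNorm f 2 ((volume : Measure (RSpace n)).map (act B.val))
        = eLpNorm (f ∘ act B.val) 2 volume := by
      apply eLpNorm_map_measure _ (continuous_act _).aemeasurable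
      rw [map_act_volume]
      exact hf.smul_measure _
    rw [map_act_volume, eLpNorm_smul_measure_of_ne_top (by simp)] at h3
    simpa [Function.comp_def] using h3.symm
  rw [h1, eLpNorm_const_smul, h2, ← mul_assoc]
  have h4 : ‖√|B.val.det|‖ₑ * ENNReal.ofReal |(B.val.det)⁻¹| ^ (1 / 2 : ℝ) = 1 := by
    rw [Real.enorm_eq_ofReal (Real.sqrt_nonneg _), ENNReal.ofReal_rpow_of_nonneg (abs_nonneg _)
      (by norm_num), ← Real.sqrt_eq_rpow, ← ENNReal.ofReal_mul (Real.sqrt_nonneg _),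
      ← Real.sqrt_mul hd.le, ← abs_mul, mul_inv_cancel₀ (det_GL_ne_zero B)]
    simp
  rw [h4, one_mul]

theorem memLp_weightedComp {n : ℕ} (φ : RSpace n → ℂ) (hφ : Continuous φ) (B : GL (Fin n) ℝ)
    (hB : ∀ x, ‖φ x‖ = √|B.val.det|) (f : RSpace n → ℂ) (hf : MemLp f 2 volume) :
    MemLp (fun x => φ x * f (act B.val x)) 2 volume :=
  ⟨hφ.aestronglyMeasurable.mul
    (hf.1.comp_quasiMeasurePreserving (quasiMeasurePreserving_act B)), by
    rw [eLpNorm_weightedComp φ B hB f hf.1]; exact hf.2⟩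

/-- The isometry `f ↦ φ(x) f(B x)` of `L²(ℝⁿ)`, where `|φ(x)| = |det B|^{1/2}`. -/
def weightedCompIsometry {n : ℕ} (φ : RSpace n → ℂ) (hφ : Continuous φ) (B : GL (Fin n) ℝ)
    (hB : ∀ x, ‖φ x‖ = √|B.val.det|) : L2 n →ₗᵢ[ℂ] L2 n where
  toFun f := (memLp_weightedComp φ hφ B hB f (Lp.memLp f)).toLp _
  map_add' f g := by
    rw [← MemLp.toLp_add]
    apply MemLp.toLp_congr
    filter_upwards [(quasiMeasurePreserving_act B).ae (Lp.coeFn_add f g)] with x hx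
    simp only [hx, Pi.add_apply, mul_add]
  map_smul' c f := by
    rw [RingHom.id_apply, ← MemLp.toLp_const_smul]
    apply MemLp.toLp_congr
    filter_upwards [(quasiMeasurePreserving_act B).ae (Lp.coeFn_smul c f)] with x hx
    simp only [hx, Pi.smul_apply, smul_eq_mul]
    ring
  norm_map' f := by
    change ‖(memLp_weightedComp φ hφ B hB f (Lp.memLp f)).toLp _‖ = ‖f‖
    rw [Lp.norm_toLp, eLpNorm_weightedComp φ B hB f (Lp.memLp f).1, Lp.norm_def]

theorem coeFn_weightedCompIsometry {n : ℕ} (φ : RSpace n → ℂ) (hφ : Continuous φ)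
    (B : GL (Fin n) ℝ) (hB : ∀ x, ‖φ x‖ = √|B.val.det|) (f : L2 n) :
    weightedCompIsometry φ hφ B hB f =ᵐ[volume] fun x => φ x * f (act B.val x) :=
  MemLp.coeFn_toLp (memLp_weightedComp φ hφ B hB f (Lp.memLp f))

theorem surjective_weightedCompIsometry {n : ℕ} (φ : RSpace n → ℂ) (hφ : Continuous φ)
    (B : GL (Fin n) ℝ) (hB : ∀ x, ‖φ x‖ = √|B.val.det|) :
    Function.Surjective (weightedCompIsometry φ hφ B hB) := by
  intro g
  have hd : 0 < |B.val.det| := abs_pos.2 (det_GL_ne_zero B)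
  have hne : ∀ x, φ x ≠ 0 := fun x hx => by
    have := hB x
    rw [hx, norm_zero] at this
    exact absurd this.symm (Real.sqrt_pos.2 hd).ne'
  have hdi : (B⁻¹).val.det = (B.val.det)⁻¹ := by
    rw [Matrix.coe_units_inv, Matrix.det_nonsing_inv, Ring.inverse_eq_inv']
  set ψ : RSpace n → ℂ := fun x => (φ (act (B⁻¹).val x))⁻¹ with hψ
  have hψc : Continuous ψ :=
    (hφ.comp (continuous_act _)).inv₀ fun x => hne _
  have hψn : ∀ x, ‖ψ x‖ = √|(B⁻¹).val.det| := fun x => by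
    rw [hψ, norm_inv, hB, hdi, abs_inv, Real.sqrt_inv]
  refine ⟨weightedCompIsometry ψ hψc B⁻¹ hψn g, ?_⟩
  apply Lp.ext
  filter_upwards [coeFn_weightedCompIsometry φ hφ B hB (weightedCompIsometry ψ hψc B⁻¹ hψn g),
    (quasiMeasurePreserving_act B).ae (coeFn_weightedCompIsometry ψ hψc B⁻¹ hψn g)] with x h1 h2
  have h3 : act (B⁻¹).val (act B.val x) = x := by
    rw [act_act, ← Units.val_mul, inv_mul_cancel, Units.val_one, act_one]
  rw [h1, h2, hψ]
  simp only [h3]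
  rw [mul_inv_cancel_left₀ (hne x)]

/-- The unitary operator `f ↦ φ(x) f(B x)` of `L²(ℝⁿ)`, where `|φ(x)| = |det B|^{1/2}`. -/
def weightedComp {n : ℕ} (φ : RSpace n → ℂ) (hφ : Continuous φ) (B : GL (Fin n) ℝ)
    (hB : ∀ x, ‖φ x‖ = √|B.val.det|) : UnitaryOp n :=
  LinearIsometryEquiv.ofSurjective (weightedCompIsometry φ hφ B hB)
    (surjective_weightedCompIsometry φ hφ B hB)

theorem coeFn_weightedComp {n : ℕ} (φ : RSpace n → ℂ) (hφ : Continuous φ)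
    (B : GL (Fin n) ℝ) (hB : ∀ x, ‖φ x‖ = √|B.val.det|) (f : L2 n) :
    weightedComp φ hφ B hB f =ᵐ[volume] fun x => φ x * f (act B.val x) :=
  coeFn_weightedCompIsometry φ hφ B hB f

/-! ### The generators of the metaplectic group -/

/-- The function `e^{iπ⟨A x, x⟩}`. -/
def chirpFun {n : ℕ} (A : Matrix (Fin n) (Fin n) ℝ) (x : RSpace n) : ℂ :=
  Complex.exp (Complex.I * Real.pi * (quad A x : ℝ))

theorem continuous_chirpFun {n : ℕ} (A : Matrix (Fin n) (Fin n) ℝ) :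
    Continuous (chirpFun A) := by
  unfold chirpFun
  have := continuous_quad A
  fun_prop

theorem norm_chirpFun {n : ℕ} (A : Matrix (Fin n) (Fin n) ℝ) (x : RSpace n) :
    ‖chirpFun A x‖ = 1 := by
  rw [chirpFun, mul_assoc, mul_comm, ← Complex.ofReal_mul, Complex.norm_exp_ofReal_mul_I]

/-- The unitary operator `(M_{A,I,0} f)(x) = e^{iπ⟨A x, x⟩} f(x)`. -/
def chirp {n : ℕ} (A : Matrix (Fin n) (Fin n) ℝ) : UnitaryOp n :=
  weightedComp (chirpFun A) (continuous_chirpFun A) 1 fun x => by simp [norm_chirpFun]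

theorem coeFn_chirp {n : ℕ} (A : Matrix (Fin n) (Fin n) ℝ) (f : L2 n) :
    chirp A f =ᵐ[volume] fun x => chirpFun A x * f x := by
  filter_upwards [coeFn_weightedComp (chirpFun A) (continuous_chirpFun A) 1
    (fun x => by simp [norm_chirpFun]) f] with x hx
  rw [chirp, hx, Units.val_one, act_one]

/-- The unitary operator `(M_{0,B,0}^{m} f)(x) = e^{iπm/2} |det B|^{1/2} f(B x)`
(note that `e^{iπm/2} = i^m` only depends on `m` modulo `4`). -/
def dilation {n : ℕ} (B : GL (Fin n) ℝ) (m : ZMod 4) : UnitaryOp n :=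
  weightedComp (fun _ => Complex.I ^ m.val * (√|B.val.det| : ℝ)) continuous_const B fun x => by
    rw [norm_mul, norm_pow, Complex.norm_I, one_pow, one_mul, Complex.norm_real,
      Real.norm_of_nonneg (Real.sqrt_nonneg _)]

theorem coeFn_dilation {n : ℕ} (B : GL (Fin n) ℝ) (m : ZMod 4) (f : L2 n) :
    dilation B m f =ᵐ[volume]
      fun x => Complex.I ^ m.val * (√|B.val.det| : ℝ) * f (act B.val x) :=
  coeFn_weightedComp _ _ _ _ _

/-- The unitary operator `M_{0,I,C} = e^{iπ⟨C D, D⟩}`, `D = (1/2iπ)∂`, that is the Fourier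
multiplier with symbol `e^{iπ⟨C ξ, ξ⟩}`, for the Fourier transformation
`û(ξ) = ∫ e^{-2iπ x·ξ} u(x) dx`. -/
def fourierChirp {n : ℕ} (C : Matrix (Fin n) (Fin n) ℝ) : UnitaryOp n :=
  (Lp.fourierTransformₗᵢ (RSpace n) ℂ)⁻¹ * chirp C * Lp.fourierTransformₗᵢ (RSpace n) ℂ

/-- `m` is compatible with `B`: `e^{iπm} = sign (det B)`. -/
def Compatible {n : ℕ} (B : GL (Fin n) ℝ) (m : ZMod 4) : Prop :=
  (-1 : ℝ) ^ m.val = Real.sign B.val.det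

/-- The metaplectic group `Mp(n, ℝ)`: the subgroup of the unitary group of `L²(ℝⁿ)` generated by
`± M_{A,I,0}`, `M_{0,B,0}^{m}` and `± M_{0,I,C}`, with `A`, `C` real symmetric, `B` invertible and
`m` compatible with `B`. (The operator `-Id` is `M_{0,I,0}^{2}`, so that the signs in the first
and third families need not be listed.) -/
def Mp (n : ℕ) : Subgroup (UnitaryOp n) :=
  Subgroup.closure
    ({U | ∃ A : Matrix (Fin n) (Fin n) ℝ, A.IsSymm ∧ U = chirp A} ∪
     {U | ∃ (B : GL (Fin n) ℝ) (m : ZMod 4), Compatible B m ∧ U = dilation B m} ∪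
     {U | ∃ C : Matrix (Fin n) (Fin n) ℝ, C.IsSymm ∧ U = fourierChirp C})

/-! ### The projection onto the symplectic group -/

/-- The first component `y` of `Y = (y, η) ∈ ℝⁿ × ℝⁿ`. -/
def spacePart {n : ℕ} (Y : Fin n ⊕ Fin n → ℝ) : RSpace n := WithLp.toLp 2 fun j => Y (Sum.inl j)

/-- The second component `η` of `Y = (y, η) ∈ ℝⁿ × ℝⁿ`. -/
def freqPart {n : ℕ} (Y : Fin n ⊕ Fin n → ℝ) : RSpace n := WithLp.toLp 2 fun j => Y (Sum.inr j)

/-- The Weyl quantization `η · x - y · D`, with `D = (1/2iπ)∂`, of the linear form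
`L_Y(x, ξ) = [Y, (x, ξ)] = η · x - ξ · y`, where `Y = (y, η)`, as an operator on `𝓢(ℝⁿ)`. -/
def weylLinear {n : ℕ} (Y : Fin n ⊕ Fin n → ℝ) (u : 𝓢(RSpace n, ℂ)) : 𝓢(RSpace n, ℂ) :=
  SchwartzMap.smulLeftCLM ℂ (fun x : RSpace n => ((inner ℝ (freqPart Y) x : ℝ) : ℂ)) u
    - (1 / (2 * Complex.I * Real.pi) : ℂ) • ∂_{spacePart Y} u

theorem weylLinear_apply {n : ℕ} (Y : Fin n ⊕ Fin n → ℝ) (u : 𝓢(RSpace n, ℂ)) (x : RSpace n) :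
    weylLinear Y u x = (inner ℝ (freqPart Y) x : ℝ) * u x
      - 1 / (2 * Complex.I * Real.pi) * fderiv ℝ u x (spacePart Y) := by
  have h : (fun x : RSpace n => ((inner ℝ (freqPart Y) x : ℝ) : ℂ)).HasTemperateGrowth :=
    (Complex.ofRealCLM.comp (innerSL ℝ (freqPart Y))).hasTemperateGrowth
  simp [weylLinear, SchwartzMap.smulLeftCLM_apply_apply h,
    SchwartzMap.lineDerivOp_apply_eq_fderiv]

/-- The operators `M* Op(L_Y) M` and `Op(L_{χ⁻¹Y})` on `𝓢(ℝⁿ)` coincide, for all `Y ∈ ℝ²ⁿ`. -/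
def IsSymplecticProjection {n : ℕ} (M : UnitaryOp n) (χ : symplecticGroup (Fin n) ℝ) : Prop :=
  ∀ (Y : Fin n ⊕ Fin n → ℝ) (u : 𝓢(RSpace n, ℂ)), ∃ w : 𝓢(RSpace n, ℂ),
    w.toLp 2 = M (u.toLp 2) ∧
      M.symm ((weylLinear Y w).toLp 2) = (weylLinear (χ⁻¹.val *ᵥ Y) u).toLp 2

/-- The projection `Ψ : Mp(n, ℝ) → Sp(2n, ℝ)`: `Ψ(M)` is the symplectic matrix `χ` such that
`M* Op(L_Y) M = Op(L_{χ⁻¹Y})` for all `Y ∈ ℝ²ⁿ`. -/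
def Psi {n : ℕ} (M : Mp n) : symplecticGroup (Fin n) ℝ :=
  Classical.epsilon fun χ => IsSymplecticProjection (M : UnitaryOp n) χ

/-! ### The variance and the quantity `μ` -/

/-- The variance `𝓥(f) = ∫ |x|² |f(x)|² dx`, with values in `[0, ∞]`. -/
def variance {n : ℕ} (f : RSpace n → ℂ) : ℝ≥0∞ := ∫⁻ x, ‖x‖ₑ ^ 2 * ‖f x‖ₑ ^ 2

/-- `μ(M)` is the infimum of `(𝓥(Mu) 𝓥(u))^{1/2}` over the `u ∈ 𝓢(ℝⁿ)` with `‖u‖_{L²} = 1`. -/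
def mu {n : ℕ} (M : L2 n →L[ℂ] L2 n) : ℝ≥0∞ :=
  ⨅ (u : 𝓢(RSpace n, ℂ)) (_ : ‖u.toLp 2‖ = 1),
    (variance (M (u.toLp 2)) * variance u) ^ (1 / 2 : ℝ)

/-- The Schatten norm of index `p`, for `1 ≤ p < ∞`, of a real square matrix:
`(trace |T|^p)^{1/p}` where `|T| = (T*T)^{1/2}`. -/
def schattenNorm {n : ℕ} (p : ℝ) (T : Matrix (Fin n) (Fin n) ℝ) : ℝ :=
  (CFC.sqrt (Tᵀ * T) ^ p).trace ^ (1 / p)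

end Metaplectic

end

/-! Write A = Ξ₁₁ and B = Ξ₁₂. Conjugation by M turns x_j into (Ax + BD)_j, so unitarity gives 𝓥(Mu)
= Σ_j ‖(Ax + BD)_j u‖², while 𝓥(u) = Σ_k ‖x_k u‖² (`variance_isSymplecticProjection`,
`variance_eq`). What remains is an uncertainty principle for two families of operators whose
commutators are the scalars B_{jk}/(2iπ).

Lower bound: these commutators fix Im⟨(Ax + BD)_j u, x_k u⟩ = -B_{jk}‖u‖²/(4π)
(`inner_affineOp_coordMul_im`). Summing against a contraction O with tr(OB) = tr|B| and applying
Cauchy–Schwarz gives tr|B|/(4π) (`trace_absMat_le`).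

Upper bound: on u = c·exp(-π⟨Tx,x⟩ - iπ⟨Sx,x⟩) the operator Ax + BD is multiplication by (A - BS)x +
iBTx. Take T = (|B| + ε)⁻¹, the shift being needed when B is singular, and a symmetric S with A - BS
= R, R|B| = 0; such an S exists because ABᵀ is symmetric (`exists_symm_solution`). The second
moments of u are (|B| + ε)/(4π), so both variances are at most tr|B|/(4π) + O(ε)
(`exists_almost_minimizer`). Let ε → 0. -/

noncomputable section

namespace Metaplectic

/-! ### Linear algebra: absolute value and pseudo-inverse of a real matrix -/

/-- The absolute value `(BᵀB)^{1/2}` of a real matrix. -/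
abbrev absMat {n : ℕ} (B : Matrix (Fin n) (Fin n) ℝ) : Matrix (Fin n) (Fin n) ℝ :=
  CFC.sqrt (Bᵀ * B)

section LinearAlgebra

variable {n : ℕ} (B : Matrix (Fin n) (Fin n) ℝ)

theorem absMat_nonneg : 0 ≤ absMat B := CFC.sqrt_nonneg _

theorem absMat_posSemidef : (absMat B).PosSemidef :=
  Matrix.nonneg_iff_posSemidef.1 (absMat_nonneg B)

theorem absMat_transpose : (absMat B)ᵀ = absMat B := by
  simpa using (absMat_posSemidef B).isHermitian.eq

theorem absMat_mul_self : absMat B * absMat B = Bᵀ * B := by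
  refine CFC.sqrt_mul_sqrt_self _ (Matrix.nonneg_iff_posSemidef.2 ?_)
  simpa using Matrix.posSemidef_conjTranspose_mul_self B

theorem eq_zero_of_transpose_mul_self {X : Matrix (Fin n) (Fin n) ℝ} (h : Xᵀ * X = 0) : X = 0 :=
  Matrix.conjTranspose_mul_self_eq_zero.1 (by simpa using h)

theorem eq_zero_of_mul_transpose_self {X : Matrix (Fin n) (Fin n) ℝ} (h : X * Xᵀ = 0) : X = 0 :=
  Matrix.self_mul_conjTranspose_eq_zero.1 (by simpa using h)

/-- A symmetric real matrix has a symmetric commuting pseudo-inverse. -/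
theorem exists_symm_pseudoInverse {H : Matrix (Fin n) (Fin n) ℝ} (hH : Hᵀ = H) :
    ∃ K : Matrix (Fin n) (Fin n) ℝ,
      Kᵀ = K ∧ K * H = H * K ∧ H * K * H = H ∧ K * H * K = K := by
  have hsa : IsSelfAdjoint H := by
    rw [isSelfAdjoint_iff, Matrix.star_eq_conjTranspose]; simpa using hH
  have hfin : (spectrum ℝ H).Finite := Matrix.finite_real_spectrum
  have hc : ∀ f : ℝ → ℝ, ContinuousOn f (spectrum ℝ H) := fun f => hfin.continuousOn f
  have hid : cfc (fun x : ℝ => x) H = H := cfc_id' ℝ H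
  have hr : ∀ f : ℝ → ℝ, cfc f H * H = cfc (fun x => f x * x) H := fun f => by
    rw [cfc_mul f (fun x => x) H (hc _) (hc _), hid]
  have hl : ∀ f : ℝ → ℝ, H * cfc f H = cfc (fun x => x * f x) H := fun f => by
    rw [cfc_mul (fun x => x) f H (hc _) (hc _), hid]
  -- The convention 0⁻¹ = 0 makes x x⁻¹ x = x and x⁻¹ x x⁻¹ = x⁻¹ hold at the eigenvalue 0 too;
  -- continuity is free on a finite spectrum.
  refine ⟨cfc (fun x : ℝ => x⁻¹) H, ?_, ?_, ?_, ?_⟩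
  · have h : IsSelfAdjoint (cfc (fun x : ℝ => x⁻¹) H) := cfc_predicate _ _
    rw [isSelfAdjoint_iff, Matrix.star_eq_conjTranspose] at h
    simpa using h
  · rw [hr, hl]
    simp only [mul_comm]
  · rw [hl, hr]
    simp only [mul_inv_mul_cancel, hid]
  · rw [hr, ← cfc_mul _ _ H (hc _) (hc _)]
    have h : ∀ x : ℝ, x⁻¹ * x * x⁻¹ = x⁻¹ := fun x => by by_cases hx : x = 0 <;> simp [hx]
    simp only [h]

/-- Polar decomposition: `tr (O B) = tr |B|` for some contraction `O`. -/
theorem exists_contraction_trace_eq :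
    ∃ O C : Matrix (Fin n) (Fin n) ℝ, Oᵀ * O + Cᵀ * C = 1 ∧ (O * B).trace = (absMat B).trace := by
  obtain ⟨K, hKs, hKH, hHKH, hKHK⟩ := exists_symm_pseudoInverse (absMat_transpose B)
  have hB := absMat_mul_self B
  set H := absMat B with hH
  have h1 : K * (H * H) * K = K * H := by
    calc K * (H * H) * K = K * H * (H * K) := by simp only [Matrix.mul_assoc]
      _ = K * H * K * H := by rw [← hKH, Matrix.mul_assoc (K * H) K H]
      _ = K * H := by rw [hKHK]
  have hOO : (K * Bᵀ)ᵀ * (K * Bᵀ) * ((K * Bᵀ)ᵀ * (K * Bᵀ)) = (K * Bᵀ)ᵀ * (K * Bᵀ) := by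
    calc (K * Bᵀ)ᵀ * (K * Bᵀ) * ((K * Bᵀ)ᵀ * (K * Bᵀ))
        = B * K * (K * (Bᵀ * B) * K) * (K * Bᵀ) := by
          simp only [Matrix.transpose_mul, Matrix.transpose_transpose, hKs, Matrix.mul_assoc]
      _ = B * K * (K * H * K) * Bᵀ := by rw [← hB, h1]; simp only [Matrix.mul_assoc]
      _ = (K * Bᵀ)ᵀ * (K * Bᵀ) := by
          rw [hKHK]
          simp only [Matrix.transpose_mul, Matrix.transpose_transpose, hKs, Matrix.mul_assoc]
  -- `O = K * Bᵀ` is the adjoint of the partial isometry of the polar decomposition. `OᵀO` is an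
  -- orthogonal projection, and `C` is the complementary one.
  refine ⟨K * Bᵀ, 1 - (K * Bᵀ)ᵀ * (K * Bᵀ), ?_, ?_⟩
  · have hs : ((K * Bᵀ)ᵀ * (K * Bᵀ))ᵀ = (K * Bᵀ)ᵀ * (K * Bᵀ) := by
      rw [Matrix.transpose_mul, Matrix.transpose_transpose]
    generalize (K * Bᵀ)ᵀ * (K * Bᵀ) = E at hOO hs
    rw [Matrix.transpose_sub, Matrix.transpose_one, hs, sub_mul, mul_sub, mul_sub, hOO]
    simp
  · rw [Matrix.mul_assoc, ← hB, ← Matrix.mul_assoc, hKH, hHKH]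

/-- The equation `B S = A` has a symmetric solution up to an error vanishing on the range
of `|B|`, if `A Bᵀ` is symmetric. -/
theorem exists_symm_solution {A B : Matrix (Fin n) (Fin n) ℝ} (hAB : A * Bᵀ = B * Aᵀ) :
    ∃ S R : Matrix (Fin n) (Fin n) ℝ, Sᵀ = S ∧ A = B * S + R ∧ R * absMat B = 0 := by
  obtain ⟨K, hKs, hKH, hHKH, hKHK⟩ := exists_symm_pseudoInverse (absMat_transpose B)
  have hB := absMat_mul_self B
  have hHs := absMat_transpose B
  set H := absMat B with hH
  -- `K * H` is the orthogonal projection P onto the range of |B|, and B has the same kernel as |B|.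
  have hBP : B * (K * H) = B := by
    have h : (B * (1 - K * H))ᵀ * (B * (1 - K * H)) = 0 := by
      have h1 : H * (1 - K * H) = 0 := by rw [mul_sub, ← Matrix.mul_assoc, hHKH, mul_one, sub_self]
      calc (B * (1 - K * H))ᵀ * (B * (1 - K * H))
          = (1 - K * H)ᵀ * ((Bᵀ * B) * (1 - K * H)) := by
            rw [Matrix.transpose_mul]; simp only [Matrix.mul_assoc]
        _ = 0 := by rw [← hB, Matrix.mul_assoc, h1, mul_zero, mul_zero]
    have h2 := eq_zero_of_transpose_mul_self h
    rw [mul_sub, mul_one, sub_eq_zero] at h2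
    exact h2.symm
  set G := K * K * Bᵀ with hG
  have hGB : G * B = K * H := by
    rw [hG, Matrix.mul_assoc, ← hB, Matrix.mul_assoc, ← Matrix.mul_assoc K H H, hKH, hHKH, hKH]
  have hPs : (K * H)ᵀ = K * H := by rw [Matrix.transpose_mul, hHs, hKs, hKH]
  -- G is a pseudo-inverse of B with GB = P. The block GAP = G(ABᵀ)Gᵀ is symmetric by `hAB`; adding
  -- the transpose of GA(1 - P) symmetrizes the rest of GA, and B kills that transpose since B(1 -
  -- P) = 0.
  refine ⟨G * A + (G * A * (1 - K * H))ᵀ, A - B * G * A, ?_, ?_, ?_⟩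
  · have h1 : G * A * (K * H) = (G * A * (K * H))ᵀ := by
      have h2 : K * H = Bᵀ * Gᵀ := by rw [← hPs, ← hGB, Matrix.transpose_mul]
      calc G * A * (K * H) = G * (A * Bᵀ) * Gᵀ := by rw [h2]; simp only [Matrix.mul_assoc]
        _ = G * (A * Bᵀ)ᵀ * Gᵀ := by
          conv_rhs => rw [Matrix.transpose_mul, Matrix.transpose_transpose, ← hAB]
        _ = (G * A * (K * H))ᵀ := by
          rw [h2]; simp only [Matrix.transpose_mul, Matrix.transpose_transpose, Matrix.mul_assoc]
    rw [mul_sub, mul_one, Matrix.transpose_add, Matrix.transpose_sub, ← h1,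
      Matrix.transpose_sub, Matrix.transpose_transpose, ← h1]
    abel
  · have h1 : B * (G * A * (1 - K * H))ᵀ = 0 := by
      rw [Matrix.transpose_mul, ← Matrix.mul_assoc, Matrix.transpose_sub, hPs, mul_sub,
        Matrix.transpose_one, mul_one, hBP, sub_self, zero_mul]
    rw [mul_add, h1]
    simp only [Matrix.mul_assoc]
    abel
  · have hRB : (A - B * G * A) * Bᵀ = 0 := by
      rw [sub_mul, Matrix.mul_assoc (B * G), hAB, ← Matrix.mul_assoc, Matrix.mul_assoc B G B, hGB,
        hBP, sub_self]
    apply eq_zero_of_mul_transpose_self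
    rw [Matrix.transpose_mul, hHs, Matrix.mul_assoc _ H, ← Matrix.mul_assoc H, hB,
      Matrix.mul_assoc Bᵀ, ← Matrix.mul_assoc _ Bᵀ, hRB, zero_mul]

/-- A positive semidefinite matrix `H` shifted by `ε > 0` is the inverse of some `LᵀL`. -/
theorem exists_transpose_mul_self_eq_inv {H : Matrix (Fin n) (Fin n) ℝ} (hH : H.PosSemidef)
    {ε : ℝ} (hε : 0 < ε) :
    ∃ L : GL (Fin n) ℝ, (L.valᵀ * L.val) * (H + ε • 1) = 1 ∧
      (H + ε • 1) * (L.valᵀ * L.val) = 1 := by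
  have hp : (H + ε • (1 : Matrix (Fin n) (Fin n) ℝ)).PosDef :=
    Matrix.PosDef.posSemidef_add hH (Matrix.PosDef.one.smul hε)
  have hu := (Matrix.isUnit_iff_isUnit_det _).1 hp.isUnit
  have hs := CFC.sqrt_mul_sqrt_self (H + ε • (1 : Matrix (Fin n) (Fin n) ℝ))⁻¹
    (Matrix.nonneg_iff_posSemidef.2 hp.inv.posSemidef)
  have ht : (CFC.sqrt (H + ε • (1 : Matrix (Fin n) (Fin n) ℝ))⁻¹)ᵀ
      = CFC.sqrt (H + ε • (1 : Matrix (Fin n) (Fin n) ℝ))⁻¹ := by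
    simpa using (Matrix.nonneg_iff_posSemidef.1
      (CFC.sqrt_nonneg (H + ε • (1 : Matrix (Fin n) (Fin n) ℝ))⁻¹)).isHermitian.eq
  have hL : IsUnit (CFC.sqrt (H + ε • (1 : Matrix (Fin n) (Fin n) ℝ))⁻¹) := by
    apply isUnit_of_mul_isUnit_left (y := CFC.sqrt (H + ε • (1 : Matrix (Fin n) (Fin n) ℝ))⁻¹)
    rw [hs]
    exact hp.inv.isUnit
  refine ⟨hL.unit, ?_, ?_⟩
  · rw [IsUnit.unit_spec, ht, hs, Matrix.nonsing_inv_mul _ hu]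
  · rw [IsUnit.unit_spec, ht, hs, Matrix.mul_nonsing_inv _ hu]

end LinearAlgebra


/-! ### The action of matrices on `ℝⁿ` -/

section Act

variable {n : ℕ}

/-- The action of a matrix on `ℝⁿ`, as a continuous linear map. -/
def actCLM (B : Matrix (Fin n) (Fin n) ℝ) : RSpace n →L[ℝ] RSpace n :=
  (Matrix.toLpLin 2 2 B).toContinuousLinearMap

@[simp]
theorem actCLM_apply (B : Matrix (Fin n) (Fin n) ℝ) (x : RSpace n) : actCLM B x = act B x := rfl

/-- The action of an invertible matrix on `ℝⁿ`, as a continuous linear equivalence. -/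
def actEquiv (B : GL (Fin n) ℝ) : RSpace n ≃L[ℝ] RSpace n :=
  ContinuousLinearEquiv.equivOfInverse (actCLM B.val) (actCLM (B⁻¹).val)
    (fun x => by
      rw [actCLM_apply, actCLM_apply, act_act, ← Units.val_mul, inv_mul_cancel, Units.val_one,
        act_one])
    (fun x => by
      rw [actCLM_apply, actCLM_apply, act_act, ← Units.val_mul, mul_inv_cancel, Units.val_one,
        act_one])

theorem inner_eq_dotProduct (x y : RSpace n) : inner ℝ x y = x.ofLp ⬝ᵥ y.ofLp := by
  simp [PiLp.inner_apply, dotProduct, mul_comm]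

theorem inner_act_left (B : Matrix (Fin n) (Fin n) ℝ) (x y : RSpace n) :
    inner ℝ (act B x) y = inner ℝ x (act Bᵀ y) := by
  simp only [inner_eq_dotProduct, act]
  rw [Matrix.mulVec_transpose, dotProduct_comm, Matrix.dotProduct_mulVec, dotProduct_comm]

theorem quad_eq_inner (A : Matrix (Fin n) (Fin n) ℝ) (x : RSpace n) :
    quad A x = inner ℝ (act A x) x := by
  rw [inner_eq_dotProduct]; rfl

theorem hasFDerivAt_quad {A : Matrix (Fin n) (Fin n) ℝ} (hA : A.IsSymm) (x : RSpace n) :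
    HasFDerivAt (quad A) ((2 : ℝ) • innerSL ℝ (act A x)) x := by
  have h := ((actCLM A).hasFDerivAt (x := x)).inner ℝ (hasFDerivAt_id x)
  have h2 : quad A = fun x => inner ℝ (actCLM A x) (id x) := by
    ext x; exact quad_eq_inner A x
  rw [h2]
  refine h.congr_fderiv ?_
  ext v
  have h3 : inner ℝ (act A v) x = inner ℝ (act A x) v := by
    rw [inner_act_left, hA.eq, real_inner_comm]
  simp [h3]
  ring

theorem hasTemperateGrowth_quad (A : Matrix (Fin n) (Fin n) ℝ) :
    (quad A).HasTemperateGrowth := by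
  have h2 : quad A = fun x => innerSL ℝ (actCLM A x) (id x) := by
    ext x; exact quad_eq_inner A x
  rw [h2]
  exact (innerSL ℝ).bilinear_hasTemperateGrowth (actCLM A).hasTemperateGrowth .id

/-- The k-th derivative has constant modulus π^k. Composed with a quadratic form, this lets chirps
act on Schwartz functions. -/
theorem hasTemperateGrowth_exp_I :
    (fun t : ℝ => Complex.exp (Complex.I * Real.pi * (t : ℝ))).HasTemperateGrowth := by
  have hd : ∀ k : ℕ, iteratedDeriv k (fun t : ℝ => Complex.exp (Complex.I * Real.pi * (t : ℝ)))
      = fun t : ℝ => (Complex.I * Real.pi) ^ k * Complex.exp (Complex.I * Real.pi * (t : ℝ)) := by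
    intro k
    induction k with
    | zero => simp
    | succ k ih =>
      rw [iteratedDeriv_succ, ih]
      ext t
      have h : HasDerivAt (fun t : ℝ => Complex.I * Real.pi * (t : ℂ)) (Complex.I * Real.pi) t := by
        simpa using (Complex.ofRealCLM.hasDerivAt (x := t)).const_mul (Complex.I * Real.pi)
      rw [(h.cexp.const_mul _).deriv]
      ring
  refine ⟨(contDiff_const.mul Complex.ofRealCLM.contDiff).cexp, fun k => ⟨0, Real.pi ^ k, fun t => ?_⟩⟩
  rw [norm_iteratedFDeriv_eq_norm_iteratedDeriv, hd]
  have h : ‖Complex.exp (Complex.I * Real.pi * (t : ℝ))‖ = 1 := by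
    rw [mul_assoc, mul_comm, ← Complex.ofReal_mul, Complex.norm_exp_ofReal_mul_I]
  simp [h, abs_of_pos Real.pi_pos]

theorem hasTemperateGrowth_chirpFun (A : Matrix (Fin n) (Fin n) ℝ) :
    (chirpFun A).HasTemperateGrowth :=
  hasTemperateGrowth_exp_I.comp (hasTemperateGrowth_quad A)

theorem hasFDerivAt_chirpFun {A : Matrix (Fin n) (Fin n) ℝ} (hA : A.IsSymm) (x : RSpace n) :
    HasFDerivAt (chirpFun A)
      (chirpFun A x • (Complex.I * Real.pi * 2) •
        (Complex.ofRealCLM.comp (innerSL ℝ (act A x)))) x := by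
  have h := (Complex.ofRealCLM.hasFDerivAt.comp x (hasFDerivAt_quad hA x)).const_mul
    (Complex.I * Real.pi)
  refine h.cexp.congr_fderiv ?_
  ext v
  simp [chirpFun]
  ring

theorem chirpFun_neg_mul (A : Matrix (Fin n) (Fin n) ℝ) (x : RSpace n) :
    chirpFun (-A) x * chirpFun A x = 1 := by
  rw [chirpFun, chirpFun, ← Complex.exp_add]
  simp [quad, Matrix.neg_mulVec]

end Act

/-! ### Intertwining relations on the Schwartz space -/

section Intertwining

variable {n : ℕ}

/-- The unitary operator `M` restricts to an automorphism of `𝓢(ℝⁿ)` that conjugates `Op(L_Y)` to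
`Op(L_{σY})` for a symplectic matrix `σ`. -/
def ActsSymplectically (M : UnitaryOp n) : Prop :=
  ∃ (e : 𝓢(RSpace n, ℂ) ≃ₗ[ℂ] 𝓢(RSpace n, ℂ)) (σ : symplecticGroup (Fin n) ℝ),
    (∀ u, M (u.toLp 2) = (e u).toLp 2) ∧
      ∀ Y u, weylLinear Y (e u) = e (weylLinear (σ.val *ᵥ Y) u)

theorem ActsSymplectically.exists_isSymplecticProjection {M : UnitaryOp n}
    (h : ActsSymplectically M) : ∃ χ, IsSymplecticProjection M χ := by
  obtain ⟨e, σ, hM, hσ⟩ := h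
  -- `ActsSymplectically` records M* Op(L_Y) M = Op(L_{σY}), whereas Ψ is normalized with χ⁻¹.
  refine ⟨σ⁻¹, fun Y u => ⟨e u, (hM u).symm, ?_⟩⟩
  rw [hσ, ← hM, inv_inv]
  exact M.symm_apply_apply _

theorem ActsSymplectically.of_inverse {M : UnitaryOp n}
    (e f : 𝓢(RSpace n, ℂ) →ₗ[ℂ] 𝓢(RSpace n, ℂ)) (hef : ∀ u, e (f u) = u) (hfe : ∀ u, f (e u) = u)
    {σ : Matrix (Fin n ⊕ Fin n) (Fin n ⊕ Fin n) ℝ}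
    (hσ : σ ∈ symplecticGroup (Fin n) ℝ) (hM : ∀ u, M (u.toLp 2) = (e u).toLp 2)
    (he : ∀ Y u, weylLinear Y (e u) = e (weylLinear (σ *ᵥ Y) u)) : ActsSymplectically M :=
  ⟨{ e with invFun := f, left_inv := hfe, right_inv := hef }, ⟨σ, hσ⟩, hM, he⟩

theorem ActsSymplectically.one : ActsSymplectically (1 : UnitaryOp n) :=
  ⟨LinearEquiv.refl _ _, 1, fun _ => rfl, fun Y u => by simp⟩

theorem ActsSymplectically.mul {M N : UnitaryOp n} (hM : ActsSymplectically M)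
    (hN : ActsSymplectically N) : ActsSymplectically (M * N) := by
  obtain ⟨e, σ, he, hσ⟩ := hM
  obtain ⟨f, τ, hf, hτ⟩ := hN
  refine ⟨f.trans e, τ * σ, fun u => ?_, fun Y u => ?_⟩
  · change M (N (u.toLp 2)) = _
    rw [hf, he]; rfl
  · rw [LinearEquiv.trans_apply, LinearEquiv.trans_apply, hσ, hτ]
    simp [Matrix.mulVec_mulVec]

theorem ActsSymplectically.inv {M : UnitaryOp n} (hM : ActsSymplectically M) :
    ActsSymplectically M⁻¹ := by
  obtain ⟨e, σ, he, hσ⟩ := hM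
  refine ⟨e.symm, σ⁻¹, fun u => ?_, fun Y u => ?_⟩
  · refine M.symm_apply_eq.2 ?_
    rw [he, LinearEquiv.apply_symm_apply]
  · rw [LinearEquiv.eq_symm_apply, ← LinearEquiv.apply_symm_apply e u]
    have h := hσ (σ⁻¹.val *ᵥ Y) (e.symm u)
    rw [Matrix.mulVec_mulVec] at h
    have h2 : σ.val * σ⁻¹.val = 1 := by
      exact congrArg Subtype.val (mul_inv_cancel σ)
    rw [h2, Matrix.one_mulVec] at h
    rw [LinearEquiv.symm_apply_apply, h]

theorem spacePart_fromBlocks (A B C D : Matrix (Fin n) (Fin n) ℝ) (Y : Fin n ⊕ Fin n → ℝ) :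
    spacePart (fromBlocks A B C D *ᵥ Y) = act A (spacePart Y) + act B (freqPart Y) := by
  ext j
  simp [spacePart, freqPart, act, Matrix.fromBlocks_mulVec, Function.comp_def]

theorem freqPart_fromBlocks (A B C D : Matrix (Fin n) (Fin n) ℝ) (Y : Fin n ⊕ Fin n → ℝ) :
    freqPart (fromBlocks A B C D *ᵥ Y) = act C (spacePart Y) + act D (freqPart Y) := by
  ext j
  simp [spacePart, freqPart, act, Matrix.fromBlocks_mulVec, Function.comp_def]

theorem weylLinear_apply' (Y : Fin n ⊕ Fin n → ℝ) (u : 𝓢(RSpace n, ℂ)) (x : RSpace n) :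
    weylLinear Y u x = (inner ℝ (freqPart Y) x : ℝ) * u x
      - 1 / (2 * Complex.I * Real.pi) * ∂_{spacePart Y} u x := by
  rw [weylLinear_apply, SchwartzMap.lineDerivOp_apply_eq_fderiv]

/-- Multiplication of Schwartz functions by `e^{iπ⟨A x, x⟩}`. -/
def chirpSchwartz (A : Matrix (Fin n) (Fin n) ℝ) : 𝓢(RSpace n, ℂ) →ₗ[ℂ] 𝓢(RSpace n, ℂ) :=
  (SchwartzMap.smulLeftCLM ℂ (chirpFun A)).toLinearMap

theorem chirpSchwartz_apply (A : Matrix (Fin n) (Fin n) ℝ) (u : 𝓢(RSpace n, ℂ)) (x : RSpace n) :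
    chirpSchwartz A u x = chirpFun A x * u x :=
  SchwartzMap.smulLeftCLM_apply_apply (hasTemperateGrowth_chirpFun A) u x

theorem lineDeriv_chirpSchwartz {A : Matrix (Fin n) (Fin n) ℝ} (hA : A.IsSymm)
    (u : 𝓢(RSpace n, ℂ)) (m x : RSpace n) :
    ∂_{m} (chirpSchwartz A u) x = chirpFun A x * (∂_{m} u x +
      (Complex.I * Real.pi * 2) * (inner ℝ (act A x) m : ℝ) * u x) := by
  have h : ⇑(chirpSchwartz A u) = fun x => chirpFun A x * u x := by
    ext x; exact chirpSchwartz_apply A u x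
  rw [SchwartzMap.lineDerivOp_apply_eq_fderiv, SchwartzMap.lineDerivOp_apply_eq_fderiv, h,
    ((hasFDerivAt_chirpFun hA x).fun_mul (u.hasFDerivAt x)).fderiv]
  simp
  ring

/-- Conjugation by the chirp replaces D by D + Ax, so (y, η) becomes (y, η - Ay). -/
theorem actsSymplectically_chirp {A : Matrix (Fin n) (Fin n) ℝ} (hA : A.IsSymm) :
    ActsSymplectically (chirp A) := by
  have hmem : fromBlocks 1 0 (-A) 1 ∈ symplecticGroup (Fin n) ℝ := by
    rw [SymplecticGroup.fromBlocks_mem_iff]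
    simp [hA.eq]
  refine .of_inverse (chirpSchwartz A) (chirpSchwartz (-A)) (fun u => ?_) (fun u => ?_) hmem
    (fun u => ?_) fun Y u => ?_
  · ext x
    rw [chirpSchwartz_apply, chirpSchwartz_apply, ← mul_assoc, mul_comm (chirpFun A x),
      chirpFun_neg_mul, one_mul]
  · ext x
    rw [chirpSchwartz_apply, chirpSchwartz_apply, ← mul_assoc, chirpFun_neg_mul, one_mul]
  · apply Lp.ext
    filter_upwards [coeFn_chirp A (u.toLp 2), u.coeFn_toLp 2,
      (chirpSchwartz A u).coeFn_toLp 2] with x h1 h2 h3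
    rw [h1, h2, h3, chirpSchwartz_apply]
  · ext x
    rw [weylLinear_apply', chirpSchwartz_apply, chirpSchwartz_apply, weylLinear_apply',
      lineDeriv_chirpSchwartz hA, spacePart_fromBlocks, freqPart_fromBlocks]
    have h0 : act (0 : Matrix (Fin n) (Fin n) ℝ) (freqPart Y) = 0 := by simp [act]
    have h1 : act (-A) (spacePart Y) = - act A (spacePart Y) := by
      simp [act, Matrix.neg_mulVec]
    have h2 : inner ℝ (act A (spacePart Y)) x = inner ℝ (act A x) (spacePart Y) := by
      rw [inner_act_left, hA.eq, real_inner_comm]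
    rw [act_one, act_one, h0, h1, add_zero, inner_add_left, inner_neg_left, h2]
    have := Complex.I_ne_zero
    have : (Real.pi : ℂ) ≠ 0 := by exact_mod_cast Real.pi_ne_zero
    push_cast
    field_simp
    ring

/-- Composition of Schwartz functions with an invertible matrix. -/
def compSchwartz (B : GL (Fin n) ℝ) : 𝓢(RSpace n, ℂ) →ₗ[ℂ] 𝓢(RSpace n, ℂ) :=
  (SchwartzMap.compCLMOfContinuousLinearEquiv ℂ (actEquiv B)).toLinearMap

theorem compSchwartz_apply (B : GL (Fin n) ℝ) (u : 𝓢(RSpace n, ℂ)) (x : RSpace n) :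
    compSchwartz B u x = u (act B.val x) := rfl

theorem lineDeriv_compSchwartz (B : GL (Fin n) ℝ) (u : 𝓢(RSpace n, ℂ)) (m x : RSpace n) :
    ∂_{m} (compSchwartz B u) x = ∂_{act B.val m} u (act B.val x) := by
  have h := SchwartzMap.lineDerivOp_compCLMOfContinuousLinearEquiv ℂ m (actEquiv B) u
  exact congrArg (fun f : 𝓢(RSpace n, ℂ) => f x) h

theorem actsSymplectically_dilation (B : GL (Fin n) ℝ) (m : ZMod 4) :
    ActsSymplectically (dilation B m) := by
  have hBB : B.val * (B⁻¹).val = 1 := by rw [← Units.val_mul, mul_inv_cancel, Units.val_one]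
  have hBB' : (B⁻¹).val * B.val = 1 := by rw [← Units.val_mul, inv_mul_cancel, Units.val_one]
  have hmem : fromBlocks B.val 0 0 (B⁻¹).valᵀ ∈ symplecticGroup (Fin n) ℝ := by
    rw [SymplecticGroup.fromBlocks_mem_iff]
    refine ⟨by simp, by simp, ?_⟩
    rw [← Matrix.transpose_mul, hBB']
    simp
  have hc : Complex.I ^ m.val * (√|B.val.det| : ℝ) ≠ 0 := by
    refine mul_ne_zero (pow_ne_zero _ Complex.I_ne_zero) ?_
    exact_mod_cast (Real.sqrt_pos.2 (abs_pos.2 (det_GL_ne_zero B))).ne'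
  set c := Complex.I ^ m.val * (√|B.val.det| : ℝ) with hcdef
  refine .of_inverse (c • compSchwartz B) (c⁻¹ • compSchwartz B⁻¹) (fun u => ?_) (fun u => ?_) hmem
    (fun u => ?_) fun Y u => ?_
  · ext x
    change c * (c⁻¹ * u (act (B⁻¹).val (act B.val x))) = u x
    rw [act_act, hBB', act_one, mul_inv_cancel_left₀ hc]
  · ext x
    change c⁻¹ * (c * u (act B.val (act (B⁻¹).val x))) = u x
    rw [act_act, hBB, act_one, inv_mul_cancel_left₀ hc]
  · apply Lp.ext
    filter_upwards [coeFn_dilation B m (u.toLp 2),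
      (quasiMeasurePreserving_act B).ae (u.coeFn_toLp 2 volume),
      (c • compSchwartz B u).coeFn_toLp 2] with x h1 h2 h3
    rw [h1, h2, LinearMap.smul_apply, h3]
    rfl
  · ext x
    simp only [LinearMap.smul_apply]
    rw [weylLinear_apply', LineDeriv.lineDerivOp_smul]
    change _ * (c * u (act B.val x)) - _ * (c * ∂_{spacePart Y} (compSchwartz B u) x) =
      c * weylLinear _ u (act B.val x)
    rw [lineDeriv_compSchwartz, weylLinear_apply', spacePart_fromBlocks, freqPart_fromBlocks]
    have h0 : ∀ z, act (0 : Matrix (Fin n) (Fin n) ℝ) z = 0 := fun z => by simp [act]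
    rw [h0, h0, add_zero, zero_add, inner_act_left, Matrix.transpose_transpose, act_act, hBB',
      act_one]
    ring

/-- A Fourier multiplier is a chirp conjugated by the Fourier transformation, so the latter is
needed although it is not a listed generator. It exchanges x and D up to sign, which is the action
of J. -/
theorem actsSymplectically_fourier :
    ActsSymplectically (Lp.fourierTransformₗᵢ (RSpace n) ℂ) := by
  refine ⟨FourierTransform.fourierEquiv ℂ 𝓢(RSpace n, ℂ), ⟨_, SymplecticGroup.J_mem _ _⟩, fun u => ?_,
    fun Y u => ?_⟩
  · exact SchwartzMap.toLp_fourier_eq u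
  · have hJ : Matrix.J (Fin n) ℝ = fromBlocks 0 (-1) 1 0 := rfl
    have hs : spacePart (Matrix.J (Fin n) ℝ *ᵥ Y) = - freqPart Y := by
      rw [hJ, spacePart_fromBlocks]
      simp [act, Matrix.neg_mulVec]
    have hf : freqPart (Matrix.J (Fin n) ℝ *ᵥ Y) = spacePart Y := by
      rw [hJ, freqPart_fromBlocks]
      simp [act]
    change weylLinear Y (𝓕 u) = 𝓕 (weylLinear (Matrix.J (Fin n) ℝ *ᵥ Y) u)
    have hreal : ∀ (a : RSpace n) (v : 𝓢(RSpace n, ℂ)),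
        SchwartzMap.smulLeftCLM ℂ (fun x : RSpace n => ((inner ℝ a x : ℝ) : ℂ)) v
          = SchwartzMap.smulLeftCLM ℂ (fun x : RSpace n => inner ℝ x a) v := fun a v => by
      ext x
      have h1 : (fun x : RSpace n => ((inner ℝ a x : ℝ) : ℂ)).HasTemperateGrowth :=
        (Complex.ofRealCLM.comp (innerSL ℝ a)).hasTemperateGrowth
      have h2 : (fun x : RSpace n => inner ℝ x a).HasTemperateGrowth := by fun_prop
      rw [SchwartzMap.smulLeftCLM_apply_apply h1, SchwartzMap.smulLeftCLM_apply_apply h2,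
        real_inner_comm, smul_eq_mul, Complex.real_smul]
    have hc : (1 / (2 * Complex.I * Real.pi) : ℂ) * (2 * Real.pi * Complex.I) = 1 := by
      have := Complex.I_ne_zero
      have : (Real.pi : ℂ) ≠ 0 := by exact_mod_cast Real.pi_ne_zero
      field_simp
    rw [weylLinear, weylLinear, hs, hf, hreal, hreal, SchwartzMap.lineDerivOp_fourier_eq,
      sub_eq_add_neg, sub_eq_add_neg, FourierTransform.fourier_add, FourierTransform.fourier_neg,
      FourierTransform.fourier_smul, FourierTransform.fourier_smul,
      SchwartzMap.fourier_lineDerivOp_eq, smul_smul, smul_smul, mul_neg, hc]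
    have hg : (fun x : RSpace n => inner ℝ x (freqPart Y)).HasTemperateGrowth := by fun_prop
    simp [SchwartzMap.smulLeftCLM_fun_neg hg, add_comm]

theorem actsSymplectically_of_mem_Mp {M : UnitaryOp n} (hM : M ∈ Mp n) : ActsSymplectically M := by
  induction hM using Subgroup.closure_induction with
  | mem M h =>
    rcases h with (⟨A, hA, rfl⟩ | ⟨B, m, -, rfl⟩) | ⟨C, hC, rfl⟩
    · exact actsSymplectically_chirp hA
    · exact actsSymplectically_dilation B m
    · exact (actsSymplectically_fourier.inv.mul (actsSymplectically_chirp hC)).mul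
        actsSymplectically_fourier
  | one => exact .one
  | mul M N _ _ hM hN => exact hM.mul hN
  | inv M _ hM => exact hM.inv

/-- Existence alone suffices: everything below uses only the intertwining relation, for whichever
matrix is chosen. -/
theorem isSymplecticProjection_Psi (M : Mp n) : IsSymplecticProjection (M : UnitaryOp n) (Psi M) :=
  Classical.epsilon_spec (actsSymplectically_of_mem_Mp M.2).exists_isSymplecticProjection

end Intertwining


/-! ### Commutation relations and variances -/

section Variance

variable {n : ℕ}

/-- The operator `(A x + B D)_j` on the Schwartz space. -/
def affineOp (A B : Matrix (Fin n) (Fin n) ℝ) (j : Fin n) (u : 𝓢(RSpace n, ℂ)) : 𝓢(RSpace n, ℂ) :=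
  weylLinear (Sum.elim (-(B j)) (A j)) u

/-- Multiplication by the coordinate `x_j` on the Schwartz space. -/
abbrev coordMul (j : Fin n) (u : 𝓢(RSpace n, ℂ)) : 𝓢(RSpace n, ℂ) := affineOp 1 0 j u

theorem affineOp_apply (A B : Matrix (Fin n) (Fin n) ℝ) (j : Fin n) (u : 𝓢(RSpace n, ℂ))
    (x : RSpace n) : affineOp A B j u x = ((A *ᵥ x.ofLp) j : ℝ) * u x
      + 1 / (2 * Complex.I * Real.pi) * ∂_{WithLp.toLp 2 (B j)} u x := by
  have h : spacePart (Sum.elim (-(B j)) (A j)) = -WithLp.toLp 2 (B j) := by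
    ext; simp [spacePart]
  rw [affineOp, weylLinear_apply', h, LineDeriv.lineDerivOp_left_neg, inner_eq_dotProduct]
  simp [freqPart, Matrix.mulVec]
  rfl

theorem coordMul_apply (j : Fin n) (u : 𝓢(RSpace n, ℂ)) (x : RSpace n) :
    coordMul j u x = (x j : ℝ) * u x := by
  have h : WithLp.toLp 2 ((0 : Matrix (Fin n) (Fin n) ℝ) j) = (0 : RSpace n) := rfl
  rw [coordMul, affineOp_apply, h, SchwartzMap.lineDerivOp_apply_eq_fderiv]
  simp

theorem integrable_inner (f g : 𝓢(RSpace n, ℂ)) : Integrable fun x => inner ℂ (f x) (g x) := by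
  refine (L2.integrable_inner (𝕜 := ℂ) (f.toLp 2 volume) (g.toLp 2 volume)).congr ?_
  filter_upwards [f.coeFn_toLp 2 volume, g.coeFn_toLp 2 volume] with x hf hg
  rw [hf, hg]

theorem inner_toLp_im (f g : 𝓢(RSpace n, ℂ)) :
    (inner ℂ (f.toLp 2) (g.toLp 2)).im = ∫ x, (inner ℂ (f x) (g x)).im := by
  rw [SchwartzMap.inner_toL2_toL2_eq f g volume]
  exact (integral_im (integrable_inner f g)).symm

theorem norm_toLp_sq (f : 𝓢(RSpace n, ℂ)) : ‖f.toLp 2‖ ^ 2 = ∫ x, ‖f x‖ ^ 2 := by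
  rw [SchwartzMap.norm_toLp' (by simp) (by simp)]
  rw [ENNReal.toReal_ofNat, ← Real.rpow_natCast, ← Real.rpow_mul (by positivity)]
  simp

theorem integrable_norm_sq (f : 𝓢(RSpace n, ℂ)) : Integrable fun x => ‖f x‖ ^ 2 :=
  (SchwartzMap.memLp f 2).integrable_norm_pow (by simp)

/-- Integration by parts: `2 ∫ x_k ⟨u, ∂_y u⟩ = -y_k ‖u‖²`. -/
theorem integral_inner_lineDeriv (u : 𝓢(RSpace n, ℂ)) (y : RSpace n) (k : Fin n) :
    2 * ∫ x, inner ℝ (coordMul k u x) (∂_{y} u x) = -(y k) * ‖u.toLp 2‖ ^ 2 := by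
  -- Moving the derivative onto x_k u returns the same integral with the opposite sign, plus the
  -- term where x_k is differentiated; hence the factor 2.
  have h : ∫ x, inner ℝ (coordMul k u x) (∂_{y} u x) =
      -∫ x, inner ℝ (∂_{y} (coordMul k u) x) (u x) :=
    SchwartzMap.integral_bilinear_lineDerivOp_right_eq_neg_left (μ := volume)
      (coordMul k u) u (innerSL ℝ : ℂ →L[ℝ] ℂ →L[ℝ] ℝ) y
  have hd : ∀ x, ∂_{y} (coordMul k u) x = (y k : ℝ) • u x + (x k : ℝ) • ∂_{y} u x := fun x => by
    have hf : ⇑(coordMul k u) = fun x => (x k : ℝ) • u x := by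
      ext x; rw [coordMul_apply, Complex.real_smul]
    have hk : HasFDerivAt (fun x : RSpace n => x k) (EuclideanSpace.proj k : RSpace n →L[ℝ] ℝ) x :=
      (EuclideanSpace.proj k : RSpace n →L[ℝ] ℝ).hasFDerivAt
    rw [SchwartzMap.lineDerivOp_apply_eq_fderiv, SchwartzMap.lineDerivOp_apply_eq_fderiv, hf,
      (hk.fun_smul (u.hasFDerivAt x)).fderiv]
    simp [add_comm]
  simp only [hd] at h
  have h2 : ∀ x, inner ℝ ((y k : ℝ) • u x + (x k : ℝ) • ∂_{y} u x) (u x)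
      = y k * ‖u x‖ ^ 2 + inner ℝ (coordMul k u x) (∂_{y} u x) := fun x => by
    rw [inner_add_left, real_inner_smul_left, real_inner_smul_left, real_inner_self_eq_norm_sq,
      coordMul_apply, ← Complex.real_smul, real_inner_smul_left, real_inner_comm (u x)]
  simp only [h2] at h
  rw [integral_add ((integrable_norm_sq u).const_mul _), integral_const_mul, ← norm_toLp_sq] at h
  · linarith
  · exact (integrable_inner (coordMul k u) (∂_{y} u)).re

/-- The uncertainty identity `Im ⟨(A x + B D)_j u, x_k u⟩ = -B_{jk} ‖u‖² / (4π)`. -/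
theorem inner_affineOp_coordMul_im (A B : Matrix (Fin n) (Fin n) ℝ) (j k : Fin n)
    (u : 𝓢(RSpace n, ℂ)) :
    (inner ℂ ((affineOp A B j u).toLp 2) ((coordMul k u).toLp 2)).im
      = -(B j k) / (4 * Real.pi) * ‖u.toLp 2‖ ^ 2 := by
  have h := integral_inner_lineDeriv u (WithLp.toLp 2 (B j)) k
  have hp := Real.pi_ne_zero
  -- The part in A is a real multiple of u and pairs to a real number with x_k u; only BD
  -- contributes.
  have h2 : ∀ x, (inner ℂ (affineOp A B j u x) (coordMul k u x)).im
      = (2 * Real.pi)⁻¹ * inner ℝ (coordMul k u x) (∂_{WithLp.toLp 2 (B j)} u x) := fun x => by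
    have hI : (1 / (2 * Complex.I * Real.pi) : ℂ) = ((-(2 * Real.pi)⁻¹ : ℝ) : ℂ) * Complex.I := by
      have := Complex.I_ne_zero
      have : (Real.pi : ℂ) ≠ 0 := by exact_mod_cast Real.pi_ne_zero
      push_cast
      field_simp
      simp
    rw [affineOp_apply, coordMul_apply, hI]
    generalize ∂_{WithLp.toLp 2 (B j)} u x = d
    generalize (2 * Real.pi)⁻¹ = c
    generalize u x = w
    simp [Complex.inner, RCLike.inner_apply]
    ring
  rw [inner_toLp_im]
  simp only [h2]
  rw [integral_const_mul]
  have h3 : (∫ x, inner ℝ (coordMul k u x) (∂_{WithLp.toLp 2 (B j)} u x))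
      = -(B j k) * ‖u.toLp 2‖ ^ 2 / 2 := by
    have : (WithLp.toLp 2 (B j) : RSpace n) k = B j k := rfl
    rw [this] at h
    linarith
  rw [h3]
  field_simp
  ring

theorem ofReal_norm_toLp_sq (f : 𝓢(RSpace n, ℂ)) :
    ENNReal.ofReal (‖f.toLp 2‖ ^ 2) = ∫⁻ x, ‖f x‖ₑ ^ 2 := by
  rw [norm_toLp_sq, ofReal_integral_eq_lintegral_ofReal (integrable_norm_sq f)
    (Filter.Eventually.of_forall fun x => by positivity)]
  congr 1
  ext x
  rw [ENNReal.ofReal_pow (norm_nonneg _), ofReal_norm]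

theorem variance_eq (u : 𝓢(RSpace n, ℂ)) :
    variance u = ENNReal.ofReal (∑ k, ‖(coordMul k u).toLp 2‖ ^ 2) := by
  rw [ENNReal.ofReal_sum_of_nonneg fun k _ => by positivity]
  simp only [ofReal_norm_toLp_sq]
  rw [← lintegral_finsetSum _ fun k _ => by
    have := (coordMul k u).continuous
    fun_prop]
  rw [variance]
  congr 1
  ext x
  simp only [coordMul_apply, enorm_mul, mul_pow]
  rw [← Finset.sum_mul]
  congr 1
  rw [← ofReal_norm, ← ENNReal.ofReal_pow (norm_nonneg _), EuclideanSpace.norm_sq_eq,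
    ENNReal.ofReal_sum_of_nonneg fun k _ => by positivity]
  refine Finset.sum_congr rfl fun k _ => ?_
  rw [ENNReal.ofReal_pow (norm_nonneg _), ofReal_norm]
  simp [enorm]

/-- This symmetry expresses that the operators (Ax + BD)_j commute with one another. -/
theorem symplectic_blocks {χ : symplecticGroup (Fin n) ℝ} {A B C D : Matrix (Fin n) (Fin n) ℝ}
    (h : χ.val = fromBlocks A B C D) : A * Bᵀ = B * Aᵀ := by
  have h1 := SymplecticGroup.transpose_mem χ.2
  rw [h, Matrix.fromBlocks_transpose, SymplecticGroup.fromBlocks_mem_iff] at h1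
  simpa using h1.1

/-- The vector (0, e_j) quantizes to x_j and (-B_j, A_j) to (Ax + BD)_j, where A_j and B_j are rows;
use χ⁻¹ = -JχᵀJ. -/
theorem symplectic_inv_mulVec {χ : symplecticGroup (Fin n) ℝ} {A B C D : Matrix (Fin n) (Fin n) ℝ}
    (h : χ.val = fromBlocks A B C D) (j : Fin n) :
    χ⁻¹.val *ᵥ Sum.elim (-((0 : Matrix (Fin n) (Fin n) ℝ) j)) ((1 : Matrix (Fin n) (Fin n) ℝ) j)
      = Sum.elim (-(B j)) (A j) := by
  rw [SymplecticGroup.coe_inv, h, Matrix.J, Matrix.fromBlocks_transpose, Matrix.fromBlocks_neg,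
    Matrix.fromBlocks_multiply, Matrix.fromBlocks_multiply, Matrix.fromBlocks_mulVec, Sum.elim_comp_inl,
    Sum.elim_comp_inr]
  have h1 : ((1 : Matrix (Fin n) (Fin n) ℝ) j) = Pi.single j 1 := by
    ext k; simp [Matrix.one_apply, Pi.single_apply, eq_comm]
  have h0 : ((0 : Matrix (Fin n) (Fin n) ℝ) j) = 0 := rfl
  rw [h1, h0]
  ext (k | k) <;> simp

theorem variance_isSymplecticProjection {M : UnitaryOp n} {χ : symplecticGroup (Fin n) ℝ}
    (hM : IsSymplecticProjection M χ) {A B C D : Matrix (Fin n) (Fin n) ℝ}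
    (h : χ.val = fromBlocks A B C D) (u : 𝓢(RSpace n, ℂ)) :
    variance (M (u.toLp 2)) = ENNReal.ofReal (∑ j, ‖(affineOp A B j u).toLp 2‖ ^ 2) := by
  obtain ⟨w, hw, -⟩ := hM 0 u
  have h1 : variance (M (u.toLp 2)) = variance w := by
    rw [← hw]
    apply lintegral_congr_ae
    filter_upwards [w.coeFn_toLp 2 volume] with x hx
    rw [hx]
  rw [h1, variance_eq]
  congr 1
  refine Finset.sum_congr rfl fun j _ => ?_
  obtain ⟨w', hw', hj⟩ := hM (Sum.elim (-((0 : Matrix (Fin n) (Fin n) ℝ) j))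
    ((1 : Matrix (Fin n) (Fin n) ℝ) j)) u
  -- The Schwartz representative of Mu may a priori depend on Y; injectivity into L² rules this out.
  have hww : w' = w := SchwartzMap.injective_toLp 2 volume (hw'.trans hw.symm)
  rw [hww, symplectic_inv_mulVec h] at hj
  rw [affineOp, ← hj, LinearIsometryEquiv.norm_map]
  rfl

end Variance


/-! ### Lower bound -/

section Lower

variable {n : ℕ} {E : Type*} [NormedAddCommGroup E] [InnerProductSpace ℂ E]

theorem sum_norm_sq_matrix_sum (P : Matrix (Fin n) (Fin n) ℝ) (f : Fin n → E) :
    ∑ k, ‖∑ j, (P k j : ℂ) • f j‖ ^ 2 = ∑ j, ∑ l, (Pᵀ * P) j l * (inner ℂ (f j) (f l)).re := by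
  have h : ∀ k, ‖∑ j, (P k j : ℂ) • f j‖ ^ 2
      = ∑ j, ∑ l, P k j * P k l * (inner ℂ (f j) (f l)).re := fun k => by
    rw [← inner_self_eq_norm_sq (𝕜 := ℂ)]
    simp only [sum_inner, inner_sum, inner_smul_left, inner_smul_right, Complex.conj_ofReal,
      Finset.mul_sum, map_sum]
    rw [Finset.sum_comm]
    refine Finset.sum_congr rfl fun j _ => Finset.sum_congr rfl fun l _ => ?_
    simp
    ring
  simp only [h, Matrix.mul_apply, Matrix.transpose_apply, Finset.sum_mul]
  rw [Finset.sum_comm]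
  exact Finset.sum_congr rfl fun j _ => Finset.sum_comm

/-- Since Σ‖(Of)_k‖² + Σ‖(Cf)_k‖² = Σ‖f_j‖², applying O does not increase the total norm;
Cauchy–Schwarz, in E and then in the sum, does the rest. -/
theorem abs_sum_inner_im_le {O C : Matrix (Fin n) (Fin n) ℝ} (h : Oᵀ * O + Cᵀ * C = 1)
    (f g : Fin n → E) :
    |∑ k, ∑ j, O k j * (inner ℂ (f j) (g k)).im| ≤ √(∑ j, ‖f j‖ ^ 2) * √(∑ k, ‖g k‖ ^ 2) := by
  have h1 : ∀ k, ∑ j, O k j * (inner ℂ (f j) (g k)).im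
      = (inner ℂ (∑ j, (O k j : ℂ) • f j) (g k)).im := fun k => by
    simp
  have h2 : ∑ k, ‖∑ j, (O k j : ℂ) • f j‖ ^ 2 ≤ ∑ j, ‖f j‖ ^ 2 := by
    have h3 : ∑ k, ‖∑ j, (O k j : ℂ) • f j‖ ^ 2 + ∑ k, ‖∑ j, (C k j : ℂ) • f j‖ ^ 2
        = ∑ j, ‖f j‖ ^ 2 := by
      rw [sum_norm_sq_matrix_sum, sum_norm_sq_matrix_sum, ← Finset.sum_add_distrib]
      refine Finset.sum_congr rfl fun j _ => ?_
      rw [← Finset.sum_add_distrib]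
      simp only [← add_mul, ← Matrix.add_apply, h, Matrix.one_apply]
      simp only [ite_mul, one_mul, zero_mul, Finset.sum_ite_eq, Finset.mem_univ, if_true]
      exact inner_self_eq_norm_sq (𝕜 := ℂ) (f j)
    have h4 : 0 ≤ ∑ k, ‖∑ j, (C k j : ℂ) • f j‖ ^ 2 := by positivity
    linarith
  simp only [h1]
  calc |∑ k, (inner ℂ (∑ j, (O k j : ℂ) • f j) (g k)).im|
      ≤ ∑ k, ‖∑ j, (O k j : ℂ) • f j‖ * ‖g k‖ := by
        refine (Finset.abs_sum_le_sum_abs _ _).trans (Finset.sum_le_sum fun k _ => ?_)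
        exact (Complex.abs_im_le_norm _).trans (norm_inner_le_norm _ _)
    _ ≤ √(∑ k, ‖∑ j, (O k j : ℂ) • f j‖ ^ 2) * √(∑ k, ‖g k‖ ^ 2) :=
        Real.sum_mul_le_sqrt_mul_sqrt _ _ _
    _ ≤ √(∑ j, ‖f j‖ ^ 2) * √(∑ k, ‖g k‖ ^ 2) := by gcongr

theorem trace_absMat_mul_le {B : Matrix (Fin n) (Fin n) ℝ} {c : ℝ} {f g : Fin n → E}
    (h : ∀ j k, (inner ℂ (f j) (g k)).im = -(B j k) * c) :
    (absMat B).trace * c ≤ √(∑ j, ‖f j‖ ^ 2) * √(∑ k, ‖g k‖ ^ 2) := by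
  obtain ⟨O, C, hOC, ht⟩ := exists_contraction_trace_eq B
  refine le_trans (le_trans (le_of_eq ?_) (neg_le_abs _)) (abs_sum_inner_im_le hOC f g)
  simp only [h]
  rw [← ht, Matrix.trace, Finset.sum_mul, ← Finset.sum_neg_distrib]
  refine Finset.sum_congr rfl fun k _ => ?_
  rw [Matrix.diag_apply, Matrix.mul_apply, Finset.sum_mul, ← Finset.sum_neg_distrib]
  refine Finset.sum_congr rfl fun j _ => ?_
  ring

theorem trace_absMat_le (A B : Matrix (Fin n) (Fin n) ℝ) (u : 𝓢(RSpace n, ℂ)) :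
    (absMat B).trace * (1 / (4 * Real.pi) * ‖u.toLp 2‖ ^ 2) ≤
      √(∑ j, ‖(affineOp A B j u).toLp 2‖ ^ 2) * √(∑ k, ‖(coordMul k u).toLp 2‖ ^ 2) := by
  have h : ∀ j k, (inner ℂ ((affineOp A B j u).toLp 2) ((coordMul k u).toLp 2)).im
      = -(B j k) * (1 / (4 * Real.pi) * ‖u.toLp 2‖ ^ 2) := fun j k => by
    rw [inner_affineOp_coordMul_im]
    ring
  exact trace_absMat_mul_le h

end Lower

/-! ### Gaussian functions -/

section Gaussian

variable {n : ℕ}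

/-- A power is bounded by a factorial times an exponential, and 1 + r - πr² ≤ 2 because π > 3. -/
theorem one_add_pow_mul_exp_le (N : ℕ) {r : ℝ} (hr : 0 ≤ r) :
    (1 + r) ^ N * Real.exp (-Real.pi * r ^ 2) ≤ N.factorial * Real.exp 2 := by
  have h1 : (1 + r) ^ N ≤ N.factorial * Real.exp (1 + r) := by
    have := Real.pow_div_factorial_le_exp (1 + r) (by linarith) N
    rwa [div_le_iff₀' (by positivity)] at this
  calc (1 + r) ^ N * Real.exp (-Real.pi * r ^ 2)
      ≤ N.factorial * Real.exp (1 + r) * Real.exp (-Real.pi * r ^ 2) := by gcongr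
    _ = N.factorial * Real.exp (1 + r + -Real.pi * r ^ 2) := by rw [mul_assoc, ← Real.exp_add]
    _ ≤ N.factorial * Real.exp 2 := by
      gcongr
      nlinarith [Real.pi_gt_three, sq_nonneg (r - 1), sq_nonneg r]

theorem iteratedDeriv_ofReal_exp (k : ℕ) :
    iteratedDeriv k (fun t : ℝ => (Real.exp t : ℂ)) = fun t : ℝ => (Real.exp t : ℂ) := by
  induction k with
  | zero => simp
  | succ k ih =>
    rw [iteratedDeriv_succ, ih]
    ext t
    exact (Real.hasDerivAt_exp t).ofReal_comp.deriv

/-- The Gaussian function `e^{-π|x|²}` as a Schwartz function. -/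
def gaussianSchwartz (n : ℕ) : 𝓢(RSpace n, ℂ) where
  toFun x := (Real.exp (-Real.pi * ‖x‖ ^ 2) : ℂ)
  smooth' := Complex.ofRealCLM.contDiff.comp
    (Real.contDiff_exp.comp (contDiff_const.mul (contDiff_norm_sq ℝ)))
  decay' p m := by
    have hf : (fun x : RSpace n => -Real.pi * ‖x‖ ^ 2).HasTemperateGrowth :=
      (Function.HasTemperateGrowth.const (-Real.pi)).mul
        (Function.hasTemperateGrowth_norm_sq (RSpace n))
    obtain ⟨k, C, hC, hfC⟩ := hf.norm_iteratedFDeriv_le_uniform m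
    refine ⟨m.factorial * (1 + C) ^ m * ((p + k * m).factorial * Real.exp 2), fun x => ?_⟩
    have hx : 1 ≤ 1 + ‖x‖ := by linarith [norm_nonneg x]
    -- The bound for iterated derivatives of a composition requires i-th powers of a single D. As i
    -- ≥ 1, a base at least 1 dominates the polynomial bound.
    have hD : ∀ i, 1 ≤ i → i ≤ m →
        ‖iteratedFDeriv ℝ i (fun x : RSpace n => -Real.pi * ‖x‖ ^ 2) x‖
          ≤ ((1 + C) * (1 + ‖x‖) ^ k) ^ i := fun i hi him => by
      have h1 : 1 ≤ (1 + C) * (1 + ‖x‖) ^ k :=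
        one_le_mul_of_one_le_of_one_le (by linarith) (one_le_pow₀ hx)
      calc _ ≤ C * (1 + ‖x‖) ^ k := hfC i him x
        _ ≤ (1 + C) * (1 + ‖x‖) ^ k := by gcongr; linarith
        _ ≤ ((1 + C) * (1 + ‖x‖) ^ k) ^ i := le_self_pow₀ h1 (by omega)
    have h := norm_iteratedFDeriv_comp_le (𝕜 := ℝ) (N := ⊤) (n := m)
      (g := fun t : ℝ => (Real.exp t : ℂ)) (f := fun x : RSpace n => -Real.pi * ‖x‖ ^ 2)
      (C := Real.exp (-Real.pi * ‖x‖ ^ 2)) (D := (1 + C) * (1 + ‖x‖) ^ k)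
      (Complex.ofRealCLM.contDiff.comp Real.contDiff_exp)
      (contDiff_const.mul (contDiff_norm_sq ℝ)) (by exact le_top) x
      (fun i _ => by
        rw [norm_iteratedFDeriv_eq_norm_iteratedDeriv, iteratedDeriv_ofReal_exp,
          Complex.norm_real, Real.norm_of_nonneg (Real.exp_pos _).le]) hD
    calc ‖x‖ ^ p * _ ≤ (1 + ‖x‖) ^ p * (m.factorial * Real.exp (-Real.pi * ‖x‖ ^ 2) *
          ((1 + C) * (1 + ‖x‖) ^ k) ^ m) := by
          gcongr
          · linarith
          · exact h
      _ = m.factorial * (1 + C) ^ m *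
          ((1 + ‖x‖) ^ (p + k * m) * Real.exp (-Real.pi * ‖x‖ ^ 2)) := by
          rw [mul_pow, pow_add, pow_mul]; ring
      _ ≤ _ := mul_le_mul_of_nonneg_left
          (one_add_pow_mul_exp_le _ (norm_nonneg x)) (by positivity)

theorem gaussianSchwartz_apply (x : RSpace n) :
    gaussianSchwartz n x = (Real.exp (-Real.pi * ‖x‖ ^ 2) : ℂ) := rfl

theorem lineDeriv_gaussianSchwartz (m x : RSpace n) :
    ∂_{m} (gaussianSchwartz n) x
      = (-2 * Real.pi * inner ℝ x m : ℝ) * gaussianSchwartz n x := by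
  have h : HasFDerivAt (fun x : RSpace n => -Real.pi * ‖x‖ ^ 2)
      (-Real.pi • (2 : ℕ) • innerSL ℝ x) x :=
    (hasStrictFDerivAt_norm_sq x).hasFDerivAt.const_mul _
  have h2 := Complex.ofRealCLM.hasFDerivAt.comp x h.exp
  have h3 : fderiv ℝ (gaussianSchwartz n) x = _ := h2.fderiv
  rw [SchwartzMap.lineDerivOp_apply_eq_fderiv, h3, gaussianSchwartz_apply]
  simp
  ring

/-- The Gaussian function `e^{-π|Lx|² - iπ⟨Sx, x⟩}` as a Schwartz function. -/
def generalGaussian (L : GL (Fin n) ℝ) (S : Matrix (Fin n) (Fin n) ℝ) : 𝓢(RSpace n, ℂ) :=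
  chirpSchwartz (-S) (compSchwartz L (gaussianSchwartz n))

theorem generalGaussian_ne_zero (L : GL (Fin n) ℝ) (S : Matrix (Fin n) (Fin n) ℝ) :
    generalGaussian L S ≠ 0 := by
  intro h
  have h1 : generalGaussian L S 0 = 0 := by rw [h]; rfl
  rw [generalGaussian, chirpSchwartz_apply, compSchwartz_apply, gaussianSchwartz_apply,
    chirpFun] at h1
  simp [Complex.exp_ne_zero] at h1

theorem lineDeriv_generalGaussian (L : GL (Fin n) ℝ) {S : Matrix (Fin n) (Fin n) ℝ} (hS : S.IsSymm)
    (m x : RSpace n) : ∂_{m} (generalGaussian L S) x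
      = -2 * Real.pi * ((inner ℝ (act (L.valᵀ * L.val) x) m : ℝ)
        + Complex.I * (inner ℝ (act S x) m : ℝ)) * generalGaussian L S x := by
  have h1 : inner ℝ (act L.val x) (act L.val m) = inner ℝ (act (L.valᵀ * L.val) x) m := by
    rw [← act_act, inner_act_left L.valᵀ, Matrix.transpose_transpose]
  have h2 : act (-S) x = -act S x := by simp [act, Matrix.neg_mulVec]
  rw [generalGaussian, lineDeriv_chirpSchwartz hS.neg, lineDeriv_compSchwartz,
    lineDeriv_gaussianSchwartz, chirpSchwartz_apply, compSchwartz_apply, h1, h2, inner_neg_left]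
  push_cast
  ring

/-- On this Gaussian D acts as multiplication by (-S + iLᵀL)x. -/
theorem affineOp_generalGaussian (L : GL (Fin n) ℝ) {S : Matrix (Fin n) (Fin n) ℝ} (hS : S.IsSymm)
    (A B : Matrix (Fin n) (Fin n) ℝ) (j : Fin n) :
    affineOp A B j (generalGaussian L S) = affineOp (A - B * S) 0 j (generalGaussian L S)
      + Complex.I • affineOp (B * (L.valᵀ * L.val)) 0 j (generalGaussian L S) := by
  ext x
  have h0 : WithLp.toLp 2 ((0 : Matrix (Fin n) (Fin n) ℝ) j) = (0 : RSpace n) := rfl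
  have hin : ∀ Q : Matrix (Fin n) (Fin n) ℝ,
      inner ℝ (act Q x) (WithLp.toLp 2 (B j)) = ((B * Q) *ᵥ x.ofLp) j := fun Q => by
    rw [inner_eq_dotProduct, ← Matrix.mulVec_mulVec, dotProduct_comm]; rfl
  change _ = affineOp (A - B * S) 0 j (generalGaussian L S) x
      + Complex.I * affineOp (B * (L.valᵀ * L.val)) 0 j (generalGaussian L S) x
  rw [affineOp_apply, affineOp_apply, affineOp_apply, h0, lineDeriv_generalGaussian L hS,
    lineDeriv_generalGaussian L hS, hin, hin, Matrix.sub_mulVec, inner_zero_right]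
  have := Complex.I_ne_zero
  have : (Real.pi : ℂ) ≠ 0 := by exact_mod_cast Real.pi_ne_zero
  simp
  field_simp
  linear_combination (generalGaussian L S x * (((B * S) *ᵥ x.ofLp) j : ℝ) : ℂ) * Complex.I_sq

end Gaussian


/-! ### Upper bound -/

section Upper

variable {n : ℕ}

section Hilbert

variable {E : Type*} [NormedAddCommGroup E] [InnerProductSpace ℂ E]

/-- The matrix of the real parts of the inner products of a family of vectors. -/
def reGram (X : Fin n → E) : Matrix (Fin n) (Fin n) ℝ :=
  Matrix.of fun j k => (inner ℂ (X j) (X k)).re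

theorem sum_norm_sq_eq_trace (P : Matrix (Fin n) (Fin n) ℝ) (X : Fin n → E) :
    ∑ j, ‖∑ k, (P j k : ℂ) • X k‖ ^ 2 = (Pᵀ * P * reGram X).trace := by
  rw [sum_norm_sq_matrix_sum, Matrix.trace]
  refine Finset.sum_congr rfl fun j _ => ?_
  rw [Matrix.diag_apply, Matrix.mul_apply]
  refine Finset.sum_congr rfl fun l _ => ?_
  rw [reGram, Matrix.of_apply, ← Complex.conj_re, inner_conj_symm]

/-- Real inner products make the R part and the iQ part orthogonal for the real scalar product, so
no cross term appears. -/
theorem sum_norm_sq_complex_eq_trace (R Q : Matrix (Fin n) (Fin n) ℝ) (X : Fin n → E)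
    (hX : ∀ j k, (inner ℂ (X j) (X k)).im = 0) :
    ∑ j, ‖∑ k, (R j k : ℂ) • X k + Complex.I • ∑ k, (Q j k : ℂ) • X k‖ ^ 2
      = ((Rᵀ * R + Qᵀ * Q) * reGram X).trace := by
  rw [add_mul, Matrix.trace_add, ← sum_norm_sq_eq_trace, ← sum_norm_sq_eq_trace,
    ← Finset.sum_add_distrib]
  refine Finset.sum_congr rfl fun j _ => ?_
  have h : (inner ℂ (∑ k, (R j k : ℂ) • X k) (∑ k, (Q j k : ℂ) • X k)).im = 0 := by
    simp only [sum_inner, inner_sum, inner_smul_left, inner_smul_right, Complex.im_sum,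
      Complex.conj_ofReal, Complex.im_ofReal_mul, hX, mul_zero, Finset.sum_const_zero]
  rw [norm_add_sq (𝕜 := ℂ), inner_smul_right, norm_smul, Complex.norm_I, one_mul]
  simp only [RCLike.re_eq_complex_re, Complex.I_mul_re, h, neg_zero, mul_zero, add_zero]

theorem trace_reGram (X : Fin n → E) : (reGram X).trace = ∑ k, ‖X k‖ ^ 2 :=
  Finset.sum_congr rfl fun k _ => inner_self_eq_norm_sq (𝕜 := ℂ) (X k)

end Hilbert

theorem toLp_add' (f g : 𝓢(RSpace n, ℂ)) :
    (f + g).toLp 2 volume = f.toLp 2 volume + g.toLp 2 volume := rfl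

theorem toLp_smul' (c : ℂ) (f : 𝓢(RSpace n, ℂ)) :
    (c • f).toLp 2 volume = c • f.toLp 2 volume := rfl

theorem affineOp_smul (A B : Matrix (Fin n) (Fin n) ℝ) (j : Fin n) (c : ℂ) (u : 𝓢(RSpace n, ℂ)) :
    affineOp A B j (c • u) = c • affineOp A B j u := by
  ext x
  change _ = c * affineOp A B j u x
  rw [affineOp_apply, affineOp_apply, LineDeriv.lineDerivOp_smul]
  change _ * (c * u x) + _ * (c * ∂_{WithLp.toLp 2 (B j)} u x) = _
  ring

theorem toLp_affineOp_zero (P : Matrix (Fin n) (Fin n) ℝ) (j : Fin n) (u : 𝓢(RSpace n, ℂ)) :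
    (affineOp P 0 j u).toLp 2 = ∑ k, (P j k : ℂ) • (coordMul k u).toLp 2 := by
  have h : affineOp P 0 j u = ∑ k, (P j k : ℂ) • coordMul k u := by
    ext x
    have h0 : WithLp.toLp 2 ((0 : Matrix (Fin n) (Fin n) ℝ) j) = (0 : RSpace n) := rfl
    rw [affineOp_apply, h0, SchwartzMap.lineDerivOp_apply_eq_fderiv, _root_.sum_apply]
    have h1 : ∀ k, ((P j k : ℂ) • coordMul k u) x = (P j k : ℂ) * ((x k : ℝ) * u x) := fun k => by
      rw [← coordMul_apply]; rfl
    simp only [h1, Matrix.mulVec, dotProduct]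
    simp [Finset.sum_mul, mul_assoc]
  rw [h]
  exact map_sum (SchwartzMap.toLpCLM ℂ (E := RSpace n) ℂ 2 volume) _ _

theorem inner_coordMul_im (j k : Fin n) (u : 𝓢(RSpace n, ℂ)) :
    (inner ℂ ((coordMul j u).toLp 2) ((coordMul k u).toLp 2)).im = 0 := by
  rw [coordMul, inner_affineOp_coordMul_im]
  simp

/-- A Schwartz function of norm one satisfying the differential equations of a Gaussian. -/
theorem exists_gaussian (L : GL (Fin n) ℝ) {S : Matrix (Fin n) (Fin n) ℝ} (hS : S.IsSymm) :
    ∃ u : 𝓢(RSpace n, ℂ), ‖u.toLp 2‖ = 1 ∧ ∀ A B j, affineOp A B j u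
      = affineOp (A - B * S) 0 j u + Complex.I • affineOp (B * (L.valᵀ * L.val)) 0 j u := by
  have h0 : ‖(generalGaussian L S).toLp 2‖ ≠ 0 := fun h => by
    refine generalGaussian_ne_zero L S (SchwartzMap.injective_toLp 2 volume ?_)
    exact norm_eq_zero.1 h
  refine ⟨((‖(generalGaussian L S).toLp 2‖⁻¹ : ℝ) : ℂ) • generalGaussian L S, ?_, fun A B j => ?_⟩
  · rw [toLp_smul', norm_smul, Complex.norm_real, norm_inv, norm_norm, inv_mul_cancel₀ h0]
  · simp only [affineOp_smul]
    rw [affineOp_generalGaussian L hS, smul_add, smul_comm]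

/-- The second moments of a Gaussian. -/
theorem reGram_gaussian {T S H : Matrix (Fin n) (Fin n) ℝ} (hTH : H * T = 1)
    {u : 𝓢(RSpace n, ℂ)} (hu : ‖u.toLp 2‖ = 1)
    (hG : ∀ A B j, affineOp A B j u
      = affineOp (A - B * S) 0 j u + Complex.I • affineOp (B * T) 0 j u) :
    reGram (fun k => (coordMul k u).toLp 2) = (1 / (4 * Real.pi)) • H := by
  have h : T * reGram (fun k => (coordMul k u).toLp 2) = (1 / (4 * Real.pi)) • 1 := by
    ext j k
    -- No Gaussian integral is computed: (Sx + D)u = iTx u, so the uncertainty identity for the pair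
    -- (S, 1) reads T · `reGram` = 1/(4π).
    have h1 := inner_affineOp_coordMul_im S 1 j k u
    rw [hG, hu, toLp_add', toLp_smul', toLp_affineOp_zero, toLp_affineOp_zero, one_mul, one_mul,
      sub_self] at h1
    simp only [Matrix.zero_apply, Complex.ofReal_zero, zero_smul, Finset.sum_const_zero, zero_add,
      inner_smul_left, sum_inner, Complex.conj_I, Complex.conj_ofReal] at h1
    rw [neg_mul, Complex.neg_im, Complex.I_mul_im, Complex.re_sum] at h1
    rw [Matrix.mul_apply, Matrix.smul_apply, smul_eq_mul]
    simp only [reGram, Matrix.of_apply]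
    simp only [Complex.re_ofReal_mul] at h1
    linear_combination -h1
  calc reGram (fun k => (coordMul k u).toLp 2)
      = H * (T * reGram (fun k => (coordMul k u).toLp 2)) := by
        rw [← Matrix.mul_assoc, hTH, one_mul]
    _ = (1 / (4 * Real.pi)) • H := by rw [h, Matrix.mul_smul, mul_one]

/-- With T = LᵀL = (H + ε)⁻¹, the R term contributes ε tr(RᵀR) as RH = 0. The other is tr(TH²) = tr
H - ε tr(TH), and tr(TH) = tr(LHLᵀ) ≥ 0. -/
theorem trace_shifted_le {H R B : Matrix (Fin n) (Fin n) ℝ} {L : GL (Fin n) ℝ} {ε : ℝ} (hε : 0 < ε)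
    (hH : H.PosSemidef) (hHB : H * H = Bᵀ * B) (hR : R * H = 0)
    (h1 : (L.valᵀ * L.val) * (H + ε • 1) = 1) :
    ((Rᵀ * R + (B * (L.valᵀ * L.val))ᵀ * (B * (L.valᵀ * L.val))) * (H + ε • 1)).trace
      ≤ H.trace + ε * (Rᵀ * R).trace := by
  have hLs : (L.valᵀ * L.val)ᵀ = L.valᵀ * L.val := by
    rw [Matrix.transpose_mul, Matrix.transpose_transpose]
  have ht : 0 ≤ ((L.valᵀ * L.val) * H).trace := by
    have h := (hH.mul_mul_conjTranspose_same L.val).trace_nonneg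
    rw [Matrix.conjTranspose_eq_transpose_of_trivial] at h
    rwa [Matrix.mul_assoc, Matrix.trace_mul_comm, Matrix.mul_assoc, Matrix.trace_mul_comm] at h
  generalize L.valᵀ * L.val = T at *
  have hTH : T * H = 1 - ε • T := by
    rw [mul_add, Matrix.mul_smul, mul_one] at h1
    exact eq_sub_of_add_eq h1
  have e1 : Rᵀ * R * (H + ε • 1) = ε • (Rᵀ * R) := by
    rw [mul_add, Matrix.mul_assoc, hR, mul_zero, zero_add, Matrix.mul_smul, mul_one]
  have e2 : ((B * T)ᵀ * (B * T) * (H + ε • 1)).trace = H.trace - ε * (T * H).trace := by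
    have : (B * T)ᵀ * (B * T) * (H + ε • 1) = T * H * H := by
      rw [Matrix.transpose_mul, hLs, Matrix.mul_assoc, Matrix.mul_assoc B, h1, mul_one,
        Matrix.mul_assoc, ← hHB, Matrix.mul_assoc]
    rw [this, hTH, sub_mul, one_mul, Matrix.trace_sub, Matrix.smul_mul, Matrix.trace_smul, ← hTH]
    rfl
  rw [add_mul, Matrix.trace_add, e1, e2, Matrix.trace_smul, smul_eq_mul]
  nlinarith

/-- The constant r is tr(RᵀR), the cost of the part of A that no quadratic phase removes. It does
not depend on ε, so it disappears in the limit. -/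
theorem exists_almost_minimizer {A B : Matrix (Fin n) (Fin n) ℝ} (hAB : A * Bᵀ = B * Aᵀ) :
    ∃ r : ℝ, ∀ ε > 0, ∃ u : 𝓢(RSpace n, ℂ), ‖u.toLp 2‖ = 1 ∧
      ∑ j, ‖(affineOp A B j u).toLp 2‖ ^ 2 ≤ 1 / (4 * Real.pi) * ((absMat B).trace + ε * r) ∧
      ∑ k, ‖(coordMul k u).toLp 2‖ ^ 2 = 1 / (4 * Real.pi) * ((absMat B).trace + ε * n) := by
  obtain ⟨S, R, hS, hA, hR⟩ := exists_symm_solution hAB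
  refine ⟨(Rᵀ * R).trace, fun ε hε => ?_⟩
  obtain ⟨L, h1, h2⟩ := exists_transpose_mul_self_eq_inv (absMat_posSemidef B) hε
  obtain ⟨u, hu, hG⟩ := exists_gaussian L hS
  have hm := reGram_gaussian h2 hu hG
  refine ⟨u, hu, ?_, ?_⟩
  · have hX : ∀ j, (affineOp A B j u).toLp 2 = ∑ k, (R j k : ℂ) • (coordMul k u).toLp 2 +
        Complex.I • ∑ k, ((B * (L.valᵀ * L.val)) j k : ℂ) • (coordMul k u).toLp 2 := fun j => by
      have hAR : A - B * S = R := by rw [hA, add_sub_cancel_left]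
      rw [hG, toLp_add', toLp_smul', toLp_affineOp_zero, toLp_affineOp_zero, hAR]
    have hs := sum_norm_sq_complex_eq_trace R (B * (L.valᵀ * L.val))
      (fun k => (coordMul k u).toLp 2) (fun j k => inner_coordMul_im j k u)
    rw [hm, Matrix.mul_smul, Matrix.trace_smul, smul_eq_mul] at hs
    rw [Finset.sum_congr rfl fun j _ => congrArg (‖·‖ ^ 2) (hX j), hs]
    exact mul_le_mul_of_nonneg_left
      (trace_shifted_le hε (absMat_posSemidef B) (absMat_mul_self B) hR h1) (by positivity)
  · have h := congrArg Matrix.trace hm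
    rw [Matrix.trace_smul, Matrix.trace_add, Matrix.trace_smul, Matrix.trace_one,
      Fintype.card_fin] at h
    rw [trace_reGram] at h
    exact h

end Upper

/-! ### Equality of the two bounds and conclusion -/

theorem ofReal_mul_ofReal_rpow_half {a b : ℝ} (ha : 0 ≤ a) (hb : 0 ≤ b) :
    (ENNReal.ofReal a * ENNReal.ofReal b) ^ (1 / 2 : ℝ) = ENNReal.ofReal (√a * √b) := by
  rw [← ENNReal.ofReal_mul ha, ENNReal.ofReal_rpow_of_nonneg (mul_nonneg ha hb) (by norm_num),
    ← Real.sqrt_eq_rpow, Real.sqrt_mul ha]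

theorem mu_eq {n : ℕ} {M : UnitaryOp n} {χ : symplecticGroup (Fin n) ℝ}
    (hM : IsSymplecticProjection M χ) {A B C D : Matrix (Fin n) (Fin n) ℝ}
    (h : χ.val = fromBlocks A B C D) :
    mu M.toContinuousLinearEquiv.toContinuousLinearMap
      = ENNReal.ofReal (1 / (4 * Real.pi) * (absMat B).trace) := by
  have hv : ∀ u : 𝓢(RSpace n, ℂ), (variance
      (M.toContinuousLinearEquiv.toContinuousLinearMap (u.toLp 2)) * variance u) ^ (1 / 2 : ℝ)
        = ENNReal.ofReal (√(∑ j, ‖(affineOp A B j u).toLp 2‖ ^ 2)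
          * √(∑ k, ‖(coordMul k u).toLp 2‖ ^ 2)) := fun u => by
    have h1 : variance (M.toContinuousLinearEquiv.toContinuousLinearMap (u.toLp 2)) = _ :=
      variance_isSymplecticProjection hM h u
    rw [h1, variance_eq]
    exact ofReal_mul_ofReal_rpow_half (Finset.sum_nonneg fun _ _ => sq_nonneg _)
      (Finset.sum_nonneg fun _ _ => sq_nonneg _)
  refine le_antisymm ?_ ?_
  · obtain ⟨r, hr⟩ := exists_almost_minimizer (symplectic_blocks h)
    have hle : ∀ ε : ℝ, 0 < ε → mu M.toContinuousLinearEquiv.toContinuousLinearMap ≤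
        ENNReal.ofReal (√(1 / (4 * Real.pi) * ((absMat B).trace + ε * r))
          * √(1 / (4 * Real.pi) * ((absMat B).trace + ε * n))) := fun ε hε => by
      obtain ⟨u, hu, h1, h2⟩ := hr ε hε
      refine (iInf₂_le u hu).trans ?_
      rw [hv, h2]
      gcongr
    -- The infimum need not be attained, so the upper bound is reached only as ε → 0⁺, where the two
    -- square roots coincide.
    have hlim : Filter.Tendsto (fun ε : ℝ =>
        ENNReal.ofReal (√(1 / (4 * Real.pi) * ((absMat B).trace + ε * r))
          * √(1 / (4 * Real.pi) * ((absMat B).trace + ε * n)))) (nhdsWithin 0 (Set.Ioi 0))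
        (nhds (ENNReal.ofReal (1 / (4 * Real.pi) * (absMat B).trace))) := by
      have hc : Continuous (fun ε : ℝ =>
        ENNReal.ofReal (√(1 / (4 * Real.pi) * ((absMat B).trace + ε * r))
          * √(1 / (4 * Real.pi) * ((absMat B).trace + ε * n)))) :=
        ENNReal.continuous_ofReal.comp (by fun_prop)
      have h0 := (hc.tendsto 0).mono_left (nhdsWithin_le_nhds (s := Set.Ioi 0))
      have ht := (absMat_posSemidef B).trace_nonneg
      simp only [zero_mul, add_zero] at h0
      rwa [Real.mul_self_sqrt (by positivity)] at h0
    refine ge_of_tendsto hlim ?_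
    filter_upwards [self_mem_nhdsWithin] with ε hε using hle ε hε
  · refine le_iInf₂ fun u hu => ?_
    rw [hv]
    refine ENNReal.ofReal_le_ofReal ?_
    have := trace_absMat_le A B u
    rwa [hu, one_pow, mul_one, mul_comm] at this

theorem schattenNorm_one {n : ℕ} (T : Matrix (Fin n) (Fin n) ℝ) :
    schattenNorm 1 T = (absMat T).trace := by
  rw [schattenNorm, CFC.rpow_one _ (absMat_nonneg T), div_one, Real.rpow_one]

end Metaplectic

end

theorem mainTheorem1 (n : ℕ) (M : Metaplectic.Mp n)
    (Ξ : Matrix.symplecticGroup (Fin n) ℝ) (hΞ : Metaplectic.Psi M = Ξ)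
    (Ξ₁₁ Ξ₁₂ Ξ₂₁ Ξ₂₂ : Matrix (Fin n) (Fin n) ℝ)
    (hblocks : Ξ.val = Matrix.fromBlocks Ξ₁₁ Ξ₁₂ Ξ₂₁ Ξ₂₂) :
    Metaplectic.mu (M : Metaplectic.UnitaryOp n).toContinuousLinearEquiv.toContinuousLinearMap =
        ENNReal.ofReal (1 / (4 * Real.pi) * (CFC.sqrt (Ξ₁₂ᵀ * Ξ₁₂)).trace) ∧
      1 / (4 * Real.pi) * (CFC.sqrt (Ξ₁₂ᵀ * Ξ₁₂)).trace =
        1 / (4 * Real.pi) * Metaplectic.schattenNorm 1 Ξ₁₂ := by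
  refine ⟨Metaplectic.mu_eq (hΞ ▸ Metaplectic.isSymplecticProjection_Psi M) hblocks, ?_⟩
  rw [Metaplectic.schattenNorm_one]
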